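/- Let $\mathrm{Mod}$ be the category of pairs $(R;M)$ of a commutative ring $R$ and an $R$-module $M$; a morphism $(R;M)\to(R';M')$ is a ring homomorphism $\alpha:R\to R'$ together with an $\alpha$-semilinear map $M\to M'$. An object is free if it is isomorphic to $(\mathbb{Z}[X];\mathbb{Z}[X](Y))$ for some sets $X,Y$. Let $\mathrm{Ab}_{\mathrm{Haus}}$ be the category of Hausdorff topological abelian groups and continuous homomorphisms. Let $G$ be a profinite group, $H\le G$ an open subgroup, and $S$ a truncation set for $H$, i.e. a set of open subgroups of $H$ that is closed under passing to larger open subgroups of $H$ and under $H$-conjugation. For $V$ open in $G$ give $M^{\otimes_R G/V}$ the discrete topology. For $g\in G$ let $g\cdot(-):M^{\otimes_R G/V}\to M^{\otimes_R G/gVg^{-1}}$ be the isomorphism induced by $aV\mapsto aVg^{-1}$. The ghost group is $$\mathrm{gh}(R;M)=\Big(\prod_{U\in S}M^{\otimes_R G/U}\Big)^H=\big\{(x_U)_{U\in S} : a\cdot x_U=x_{aUa^{-1}}\text{ for all }a\in H,\ U\in S\big\},$$ with the subspace topology of the product topology; it is a functor $\mathrm{Mod}\to\mathrm{Ab}_{\mathrm{Haus}}$.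 A choice $c$ consists of a set $\underline S\subseteq S$ containing exactly one member of each $H$-conjugacy class in $S$ and, for each $V\in\underline S$, a system of representatives $(g_i)$ of the cosets $G/V$. For $U\le V$ open, with $V\in\underline S$, let $f_{G/V}:M^{\otimes_R G/V\times V/U}\to M^{\otimes_R G/U}$ be the isomorphism induced by the bijection $(g_iV,sU)\mapsto g_isU$. The ghost map of $c$ is the map $w^c:\prod_{V\in\underline S}M^{\otimes_R G/V}\to\mathrm{gh}(R;M)$ with components $$w^c_U(n)=\sum_{V\in\underline S}\ \sum_{hV\in(H/V)^U}h\cdot f_{G/V}\big(n_V^{\otimes_R V/h^{-1}Uh}\big)\qquad(U\in S),$$ where $(H/V)^U$ is the set of cosets fixed by left multiplication by $U$ (a finite sum, independent of the representatives $h$). Call a pair $(W,w)$, consisting of a functor $W:\mathrm{Mod}\to\mathrm{Ab}_{\mathrm{Haus}}$ and a natural transformation $w:W\to\mathrm{gh}$ (so a natural continuous additive map), a Witt vector functor for $c$ if: (i) there are topological quotient maps of underlying spaces $q:\prod_{V\in\underline S}M^{\otimes_R G/V}\to W(R;M)$, natural in $(R;M)$, such that $w\circ q=w^c$; (ii) for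 each free $(T;Q)$ the map $w:W(T;Q)\to\mathrm{gh}(T;Q)$ is a topological embedding, so that it induces an isomorphism of topological groups $W(T;Q)\cong\mathrm{im}(w)$; (iii) $W$ preserves reflexive coequalisers. Theorem. For every choice $c$ there is a Witt vector functor $(W,w)$ for $c$. Moreover, if $c$ and $c'$ are choices, $(W,w)$ is a Witt vector functor for $c$ and $(W',w')$ is a Witt vector functor for $c'$, then there is a unique natural isomorphism $u:W\cong W'$ with $w'\circ u=w$. -/

import Mathlib

open CategoryTheory CategoryTheory.Limits Topology

universe u

namespace GWitt

noncomputable section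

/-! ### The category of all modules -/

/-- A pair `(R; M)` of a commutative ring `R` and an `R`-module `M`. -/
structure ModPair : Type (u + 1) where
  ring : Type u
  mod : Type u
  [commRing : CommRing ring]
  [addCommGroup : AddCommGroup mod]
  [module : Module ring mod]

attribute [instance] ModPair.commRing ModPair.addCommGroup ModPair.module

/-- A morphism `(α; f) : (R; M) ⟶ (R'; M')`: a ring homomorphism `α` and an `α`-semilinear map `f`,
that is, an `R`-linear map from `M` to the restriction of scalars of `M'` along `α`. -/
structure ModPair.Hom (P Q : ModPair.{u}) : Type u where
  ringHom : P.ring →+* Q.ring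
  modHom : P.mod →ₛₗ[ringHom] Q.mod

/-- The category `Mod` of all modules over all commutative rings. -/
instance : Category ModPair.{u} where
  Hom := ModPair.Hom
  id P := ⟨RingHom.id P.ring, LinearMap.id⟩
  comp {_ _ _} f g :=
    haveI : RingHomCompTriple f.ringHom g.ringHom (g.ringHom.comp f.ringHom) := ⟨rfl⟩
    ⟨g.ringHom.comp f.ringHom, g.modHom.comp f.modHom⟩

/-- The free object `(ℤ[X]; ℤ[X](Y))` of `Mod` on a pair of sets `(X, Y)`. -/
def freeModPair (X Y : Type u) : ModPair.{u} where
  ring := MvPolynomial X ℤ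
  mod := Y →₀ MvPolynomial X ℤ

/-- `(T; Q)` is a free object of `Mod`, i.e. a free module over a free commutative ring. -/
def ModPair.IsFree (P : ModPair.{u}) : Prop :=
  ∃ X Y : Type u, Nonempty (P ≅ freeModPair X Y)

/-! ### The category of Hausdorff topological abelian groups -/

/-- A Hausdorff topological abelian group. -/
structure HausAb : Type (u + 1) where
  carrier : Type u
  [addCommGroup : AddCommGroup carrier]
  [topologicalSpace : TopologicalSpace carrier]
  [isTopologicalAddGroup : IsTopologicalAddGroup carrier]
  [t2Space : T2Space carrier]

instance : CoeSort HausAb.{u} (Type u) := ⟨HausAb.carrier⟩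

attribute [instance] HausAb.addCommGroup HausAb.topologicalSpace HausAb.isTopologicalAddGroup
  HausAb.t2Space

/-- Morphisms of Hausdorff topological abelian groups: continuous additive maps. -/
@[ext]
structure HausAb.Hom (A B : HausAb.{u}) : Type u where
  hom : A →ₜ+ B

instance : Category HausAb.{u} where
  Hom := HausAb.Hom
  id A := ⟨ContinuousAddMonoidHom.id A⟩
  comp f g := ⟨g.hom.comp f.hom⟩

/-! ### Tensor powers -/

/-- The tensor power `M^{⊗_R X}` indexed by a set `X`. -/
def TPow (P : ModPair.{u}) (X : Type u) : Type u :=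
  PiTensorProduct P.ring (fun _ : X => P.mod)

section TPow

variable (P Q : ModPair.{u}) (X Y : Type u)

instance : AddCommGroup (TPow P X) :=
  inferInstanceAs (AddCommGroup (PiTensorProduct P.ring (fun _ : X => P.mod)))

instance : Module P.ring (TPow P X) :=
  inferInstanceAs (Module P.ring (PiTensorProduct P.ring (fun _ : X => P.mod)))

/-- Tensor powers carry the discrete topology. -/
instance : TopologicalSpace (TPow P X) := ⊥

instance : DiscreteTopology (TPow P X) := ⟨rfl⟩

variable {X}

/-- The pure tensor `⨂_{x ∈ X} m_x`. -/
def TPow.tprod : MultilinearMap P.ring (fun _ : X => P.mod) (TPow P X) :=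
  PiTensorProduct.tprod P.ring

variable {P Q Y}

theorem TPow.induction {motive : TPow P X → Prop} (z : TPow P X)
    (smul : ∀ (r : P.ring) (m : X → P.mod), motive (r • TPow.tprod P m))
    (add : ∀ a b, motive a → motive b → motive (a + b)) : motive z :=
  PiTensorProduct.induction_on z smul add

variable (X) in
/-- The map `M^{⊗_R X} → M'^{⊗_{R'} X}`, `⨂ m_x ↦ ⨂ f m_x`, induced by `(α; f)`. -/
def TPow.map (f : P ⟶ Q) : TPow P X →ₛₗ[f.ringHom] TPow Q X :=
  letI : Module P.ring (TPow Q X) := Module.compHom _ f.ringHom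
  let φ : PiTensorProduct P.ring (fun _ : X => P.mod) →ₗ[P.ring] TPow Q X :=
    PiTensorProduct.lift
      { toFun := fun m => TPow.tprod Q (fun x => f.modHom (m x))
        map_update_add' := by
          intro _ m i a b
          have h (c : P.mod) : (fun x => f.modHom (Function.update m i c x))
              = Function.update (fun x => f.modHom (m x)) i (f.modHom c) := by
            funext x
            by_cases hx : x = i
            · subst hx; simp
            · simp [hx]
          simp only [h, map_add, MultilinearMap.map_update_add]
        map_update_smul' := by
          intro _ m i r a
          have h (c : P.mod) : (fun x => f.modHom (Function.update m i c x))
              = Function.update (fun x => f.modHom (m x)) i (f.modHom c) := by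
            funext x
            by_cases hx : x = i
            · subst hx; simp
            · simp [hx]
          simp only [h, LinearMap.map_smulₛₗ, MultilinearMap.map_update_smul]
          rfl }
  { toFun := φ
    map_add' := φ.map_add
    map_smul' := φ.map_smul }

@[simp]
theorem TPow.map_tprod (f : P ⟶ Q) (m : X → P.mod) :
    TPow.map X f (TPow.tprod P m) = TPow.tprod Q (fun x => f.modHom (m x)) :=
  letI : Module P.ring (TPow Q X) := Module.compHom _ f.ringHom
  PiTensorProduct.lift.tprod (R := P.ring) (E := TPow Q X) m

theorem TPow.map_id (z : TPow P X) : TPow.map X (𝟙 P) z = z := by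
  induction z using TPow.induction with
  | smul r m => rw [LinearMap.map_smulₛₗ, TPow.map_tprod]; rfl
  | add a b ha hb => rw [map_add, ha, hb]

theorem TPow.map_comp {P' : ModPair.{u}} (f : P ⟶ Q) (g : Q ⟶ P') (z : TPow P X) :
    TPow.map X (f ≫ g) z = TPow.map X g (TPow.map X f z) := by
  induction z using TPow.induction with
  | smul r m =>
    simp only [LinearMap.map_smulₛₗ, TPow.map_tprod]; rfl
  | add a b ha hb => simp only [map_add, ha, hb]

/-- The isomorphism `M^{⊗ X} ≅ M^{⊗ Y}` induced by a bijection `e : X ≃ Y`; the factor indexed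
by `x` becomes the factor indexed by `e x`. -/
def TPow.reindex (e : X ≃ Y) : TPow P X ≃ₗ[P.ring] TPow P Y :=
  PiTensorProduct.reindex P.ring (fun _ : X => P.mod) e

@[simp]
theorem TPow.reindex_tprod (e : X ≃ Y) (m : X → P.mod) :
    TPow.reindex e (TPow.tprod P m) = TPow.tprod P (fun y => m (e.symm y)) :=
  PiTensorProduct.reindex_tprod e m

theorem TPow.map_reindex (f : P ⟶ Q) (e : X ≃ Y) (z : TPow P X) :
    TPow.map Y f (TPow.reindex e z) = TPow.reindex e (TPow.map X f z) := by
  induction z using TPow.induction with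
  | smul r m => simp only [map_smul, LinearMap.map_smulₛₗ, TPow.map_tprod, TPow.reindex_tprod]
  | add a b ha hb => simp only [map_add, ha, hb]

/-- The bijection `X ⊔ (X × Y) ≃ X × (Y ⊔ {*})`. -/
def sumProdEquiv (X Y : Type u) : X ⊕ (X × Y) ≃ X × Option Y where
  toFun := Sum.elim (fun x => (x, none)) (fun p => (p.1, some p.2))
  invFun p := p.2.elim (Sum.inl p.1) (fun y => Sum.inr (p.1, y))
  left_inv := by rintro (x | ⟨x, y⟩) <;> rfl
  right_inv := by rintro ⟨x, _ | y⟩ <;> rfl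

/-- The product `M^{⊗ X} × M^{⊗ Z} → M^{⊗ X ⊔ Z}` of tensors. -/
def TPow.mul {Z : Type u} : TPow P X →ₗ[P.ring] TPow P Z →ₗ[P.ring] TPow P (X ⊕ Z) :=
  TensorProduct.curry (PiTensorProduct.tmulEquiv (ι := X) (ι₂ := Z) P.ring P.mod).toLinearMap

theorem TPow.mul_tprod {Z : Type u} (a : X → P.mod) (b : Z → P.mod) :
    TPow.mul (TPow.tprod P a) (TPow.tprod P b) = TPow.tprod P (Sum.elim a b) :=
  PiTensorProduct.tmulEquiv_apply P.ring P.mod a b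

variable (P X Y) in
/-- For finite `Y` there is a multilinear map underlying the canonical isomorphism
`(M^{⊗ X})^{⊗ Y} ≅ M^{⊗ X × Y}`; it is determined by its values on families of pure tensors. -/
theorem TPow.exists_nested [Finite Y] :
    ∃ Ψ : MultilinearMap P.ring (fun _ : Y => TPow P X) (TPow P (X × Y)),
      ∀ m : X × Y → P.mod,
        Ψ (fun y => TPow.tprod P (fun x => m (x, y))) = TPow.tprod P m := by
  induction Y using Finite.induction_empty_option with
  | of_equiv e ih =>
    obtain ⟨Ψ, hΨ⟩ := ih
    refine ⟨(TPow.reindex ((Equiv.refl X).prodCongr e)).toLinearMap.compMultilinearMap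
      (Ψ.domDomCongr e), fun m => ?_⟩
    have := hΨ (fun p => m (p.1, e p.2))
    simp only [LinearMap.compMultilinearMap_apply, MultilinearMap.domDomCongr_apply,
      LinearEquiv.coe_coe]
    rw [this, TPow.reindex_tprod]
    congr 1
    funext p
    simp
  | h_empty =>
    refine ⟨MultilinearMap.constOfIsEmpty _ _ (TPow.tprod P (fun p => p.2.elim)), fun m => ?_⟩
    rw [MultilinearMap.constOfIsEmpty_apply]
    exact congrArg (TPow.tprod P) (funext fun p => p.2.elim)
  | @h_option Y _ ih =>
    obtain ⟨Ψ, hΨ⟩ := ih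
    refine ⟨(TPow.reindex (sumProdEquiv X Y)).toLinearMap.compMultilinearMap
      { toFun := fun n => TPow.mul (n none) (Ψ (fun y => n (some y)))
        map_update_add' := ?_
        map_update_smul' := ?_ }, fun m => ?_⟩
    · intro _ n i a b
      rcases i with _ | i
      · simp
      · classical
        have h (c : TPow P X) : (fun y => Function.update n (some i) c (some y))
            = Function.update (fun y => n (some y)) i c := by
          funext y
          by_cases hy : y = i
          · subst hy; simp
          · simp [hy]
        simp [h]
    · intro _ n i r a
      rcases i with _ | i
      · simp
      · classical
        have h (c : TPow P X) : (fun y => Function.update n (some i) c (some y))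
            = Function.update (fun y => n (some y)) i c := by
          funext y
          by_cases hy : y = i
          · subst hy; simp
          · simp [hy]
        simp [h]
    · have := hΨ (fun p => m (p.1, some p.2))
      simp only [LinearMap.compMultilinearMap_apply, MultilinearMap.coe_mk, LinearEquiv.coe_coe]
      rw [this, TPow.mul_tprod, TPow.reindex_tprod]
      congr 1
      funext p
      rcases p with ⟨x, _ | y⟩ <;> rfl

variable (P X Y) in
/-- The canonical multilinear map `(M^{⊗ X})^Y → M^{⊗ X × Y}`. -/
def TPow.nested [Finite Y] : MultilinearMap P.ring (fun _ : Y => TPow P X) (TPow P (X × Y)) :=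
  (TPow.exists_nested P X Y).choose

theorem TPow.nested_tprod [Finite Y] (m : X × Y → P.mod) :
    TPow.nested P X Y (fun y => TPow.tprod P (fun x => m (x, y))) = TPow.tprod P m :=
  (TPow.exists_nested P X Y).choose_spec m

variable (Y) in
/-- The tensor power map `M^{⊗ X} → M^{⊗ X × Y}`, `n ↦ n^{⊗ Y}`. -/
def TPow.pow [Finite Y] (n : TPow P X) : TPow P (X × Y) :=
  TPow.nested P X Y (fun _ => n)

end TPow

/-! ### Open subgroups and cosets -/

section Cosets

variable {G : Type u} [Group G] [TopologicalSpace G] [IsTopologicalGroup G]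

/-- The conjugate `gVg⁻¹` of an open subgroup. -/
def conj (g : G) (V : OpenSubgroup G) : OpenSubgroup G :=
  V.comap (MulAut.conj g⁻¹).toMonoidHom (by
    change Continuous fun x : G => g⁻¹ * x * (g⁻¹)⁻¹
    fun_prop)

theorem mem_conj {g x : G} {V : OpenSubgroup G} : x ∈ conj g V ↔ g⁻¹ * x * g ∈ V := by
  change g⁻¹ * x * (g⁻¹)⁻¹ ∈ V ↔ _
  rw [inv_inv]

theorem conj_conj_inv (g : G) (V : OpenSubgroup G) : conj g (conj g⁻¹ V) = V := by
  ext x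
  simp only [mem_conj]
  simp [mul_assoc]

/-- The coset space `G / V`. -/
abbrev Cosets (V : OpenSubgroup G) : Type u := G ⧸ V.toSubgroup

/-- For `W = gVg⁻¹`, the bijection `G / V ≃ G / W`, `aV ↦ aVg⁻¹ = ag⁻¹W`. -/
def cosetConj (g : G) {V W : OpenSubgroup G} (h : conj g V = W) : Cosets V ≃ Cosets W where
  toFun := Quotient.map' (fun a => a * g⁻¹) (by
    subst h
    intro a b hab
    rw [QuotientGroup.leftRel_apply] at hab ⊢
    change _ ∈ conj g V
    rw [mem_conj]
    convert! hab using 1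
    group)
  invFun := Quotient.map' (fun a => a * g) (by
    subst h
    intro a b hab
    rw [QuotientGroup.leftRel_apply] at hab ⊢
    change _ ∈ conj g V at hab
    rw [mem_conj] at hab
    convert! hab using 1
    group)
  left_inv := by
    rintro ⟨a⟩
    change (QuotientGroup.mk (a * g⁻¹ * g) : Cosets V) = QuotientGroup.mk a
    simp
  right_inv := by
    rintro ⟨a⟩
    change (QuotientGroup.mk (a * g * g⁻¹) : Cosets W) = QuotientGroup.mk a
    simp

/-- For `W = gVg⁻¹`, the isomorphism `g · (-) : M^{⊗ G/V} ≅ M^{⊗ G/W}`. -/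
def TPow.act {P : ModPair.{u}} (g : G) {V W : OpenSubgroup G} (h : conj g V = W) :
    TPow P (Cosets V) ≃ₗ[P.ring] TPow P (Cosets W) :=
  TPow.reindex (cosetConj g h)

/-- The space `V / U` of cosets, for open subgroups `U ≤ V`. -/
abbrev RelCosets (V U : OpenSubgroup G) : Type u :=
  V.toSubgroup ⧸ U.toSubgroup.subgroupOf V.toSubgroup

instance [CompactSpace G] (V U : OpenSubgroup G) : Finite (RelCosets V U) :=
  Subgroup.quotient_finite_of_isOpen' V.toSubgroup (U.toSubgroup.subgroupOf V.toSubgroup)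
    V.isOpen (V.toSubgroup.subgroupOf_isOpen U.toSubgroup U.isOpen)

/-- Given representatives `σ` of the cosets of `V`, the bijection `G/V × V/U ≃ G/U`,
`(gV, sU) ↦ σ(gV) s U`. -/
def cosetProd {U V : OpenSubgroup G} (hUV : U ≤ V) (σ : Cosets V → G)
    (hσ : ∀ x, (QuotientGroup.mk (σ x) : Cosets V) = x) :
    Cosets V × RelCosets V U ≃ Cosets U :=
  (Subgroup.quotientEquivProdOfLE' (s := U.toSubgroup) (t := V.toSubgroup) hUV σ hσ).symm

/-- Given representatives `σ` of the cosets of `V`, the map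
`f_{G/V}((-)^{⊗ V/U}) : M^{⊗ G/V} → M^{⊗ G/U}`. -/
def TPow.cosetPow [CompactSpace G] {P : ModPair.{u}} {U V : OpenSubgroup G} (hUV : U ≤ V)
    (σ : Cosets V → G) (hσ : ∀ x, (QuotientGroup.mk (σ x) : Cosets V) = x)
    (n : TPow P (Cosets V)) : TPow P (Cosets U) :=
  TPow.reindex (cosetProd hUV σ hσ) (TPow.pow (RelCosets V U) n)

/-! ### Truncation sets and the ghost map -/

/-- A truncation set for the open subgroup `H` of `G`: a set of open subgroups of `H` that is
upwards closed and closed under conjugation in `H`. -/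
structure TruncationSet (H : OpenSubgroup G) where
  carrier : Set (OpenSubgroup G)
  le : ∀ U ∈ carrier, U ≤ H
  upward : ∀ U ∈ carrier, ∀ U' : OpenSubgroup G, U ≤ U' → U' ≤ H → U' ∈ carrier
  conj_mem : ∀ U ∈ carrier, ∀ h ∈ H, conj h U ∈ carrier

variable {H : OpenSubgroup G}

/-- The auxiliary choices: a set of distinguished representatives for the `H`-conjugacy classes of
subgroups in `S`, and representatives for the cosets `G / V` of each distinguished `V`. -/
structure Choices (S : TruncationSet H) where
  reps : Set (OpenSubgroup G)
  reps_subset : reps ⊆ S.carrier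
  existsUnique_rep : ∀ U ∈ S.carrier, ∃! V, V ∈ reps ∧ ∃ h ∈ H, conj h U = V
  sec : ∀ V : reps, Cosets V.1 → G
  mk_sec : ∀ (V : reps) (x : Cosets V.1), (QuotientGroup.mk (sec V x) : Cosets V.1) = x

/-- The set `(H/V)^U` of `U`-fixed points in `H / V`, for open subgroups `U` and `V` of `H`. -/
abbrev FixedCosets (H V U : OpenSubgroup G) : Type u :=
  MulAction.fixedPoints (U.toSubgroup.subgroupOf H.toSubgroup) (RelCosets H V)

/-- A representative `h ∈ H` of a coset `hV ∈ (H/V)^U`. -/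
def FixedCosets.rep {V U : OpenSubgroup G} (x : FixedCosets H V U) : G :=
  (Quotient.out x.1 : H.toSubgroup)

/-- If `hV` is fixed by `U` then `h⁻¹Uh ≤ V`. -/
theorem FixedCosets.conj_rep_le {V U : OpenSubgroup G} (hU : U ≤ H) (x : FixedCosets H V U) :
    conj x.rep⁻¹ U ≤ V := by
  intro u hu
  rw [mem_conj, inv_inv] at hu
  have hfix := x.2 ⟨⟨_, hU hu⟩, hu⟩
  have hx : (QuotientGroup.mk (Quotient.out x.1) : RelCosets H V) = x.1 := Quotient.out_eq' _
  rw [← hx] at hfix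
  have := QuotientGroup.eq.mp hfix.symm
  rw [Subgroup.mem_subgroupOf] at this
  change _ ∈ V at this
  convert! this using 1
  simp [FixedCosets.rep, mul_assoc]

variable [CompactSpace G] {S : TruncationSet H}

/-- The component `w_U : ∏_{V ∈ S̲} M^{⊗ G/V} → M^{⊗ G/U}` of the ghost map,
`n ↦ ∑_{V ∈ S̲} ∑_{hV ∈ (H/V)^U} h · f_{G/V}(n_V^{⊗ V/h⁻¹Uh})`. The set `(H/V)^U` is always finite,
and it is empty for all but the finitely many `V` to which `U` is subconjugate. The inner summand
does not depend on the representative `h` of the coset `hV`. -/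
def Choices.ghost (c : Choices S) {P : ModPair.{u}} (n : ∀ V : c.reps, TPow P (Cosets V.1))
    (U : S.carrier) : TPow P (Cosets U.1) :=
  ∑ᶠ V : c.reps, ∑ᶠ x : FixedCosets H V.1 U.1,
    TPow.act x.rep (conj_conj_inv x.rep U.1)
      (TPow.cosetPow (x.conj_rep_le (S.le U.1 U.2)) (c.sec V) (c.mk_sec V) (n V))

variable (S) in
/-- The ghost group `(∏_{U ∈ S} M^{⊗ G/U})^H`: the families `(x_U)` with `a · x_U = x_{aUa⁻¹}` for
all `a ∈ H` and `U ∈ S`. It has the subspace topology of the product topology. -/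
def ghostSubgroup (P : ModPair.{u}) : AddSubgroup (∀ U : S.carrier, TPow P (Cosets U.1)) where
  carrier := {x | ∀ a ∈ H, ∀ (U U' : S.carrier) (h : conj a U.1 = U'.1),
    TPow.act a h (x U) = x U'}
  zero_mem' := by intro a _ U U' h; simp
  add_mem' := by
    intro x y hx hy a ha U U' h
    simp [hx a ha U U' h, hy a ha U U' h]
  neg_mem' := by
    intro x hx a ha U U' h
    simp [hx a ha U U' h]

variable (S) in
/-- The map on ghost groups induced by a morphism of `Mod`. -/
def ghostMap {P Q : ModPair.{u}} (f : P ⟶ Q) : ghostSubgroup S P →ₜ+ ghostSubgroup S Q where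
  toFun x := ⟨fun U => TPow.map _ f (x.1 U), by
    intro a ha U U' h
    exact (TPow.map_reindex f _ _).symm.trans (congrArg _ (x.2 a ha U U' h))⟩
  map_zero' := by ext U; simp
  map_add' x y := by ext U; simp
  continuous_toFun := by
    refine Continuous.subtype_mk (continuous_pi fun U => ?_) _
    exact continuous_of_discreteTopology.comp ((continuous_apply U).comp continuous_subtype_val)

variable (S) in
/-- The ghost group functor `gh^S_{H ≤ G} : Mod ⥤ Ab_Haus`. -/
def gh : ModPair.{u} ⥤ HausAb.{u} where
  obj P := { carrier := ghostSubgroup S P }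
  map f := ⟨ghostMap S f⟩
  map_id P := by
    apply HausAb.Hom.ext
    refine ContinuousAddMonoidHom.ext fun (x : ghostSubgroup S _) => ?_
    exact Subtype.ext (funext fun U => TPow.map_id (x.1 U))
  map_comp f g := by
    apply HausAb.Hom.ext
    refine ContinuousAddMonoidHom.ext fun (x : ghostSubgroup S _) => ?_
    exact Subtype.ext (funext fun U => TPow.map_comp f g (x.1 U))

/-- The defining properties of a functor `W` of Witt vectors together with its ghost map
`w : W ⟶ gh^S_{H ≤ G}`, relative to the choices `c`. -/
structure IsWitt (c : Choices S) (W : ModPair.{u} ⥤ HausAb.{u}) (w : W ⟶ gh S) : Prop where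
  /-- There are natural topological quotient maps `q : ∏_{V ∈ S̲} M^{⊗ G/V} → W(R; M)` through which
  the ghost map factors, and `w` is the induced natural additive map. -/
  exists_quotient : ∃ q : ∀ P : ModPair.{u}, (∀ V : c.reps, TPow P (Cosets V.1)) → W.obj P,
    (∀ P, IsQuotientMap (q P)) ∧
    (∀ (P Q : ModPair.{u}) (f : P ⟶ Q) (n : ∀ V : c.reps, TPow P (Cosets V.1)),
      q Q (fun V => TPow.map _ f (n V)) = (W.map f).hom (q P n)) ∧
    (∀ (P : ModPair.{u}) (n : ∀ V : c.reps, TPow P (Cosets V.1)),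
      ((w.app P).hom (q P n)).1 = c.ghost n)
  /-- For free coefficients the ghost map is an embedding of topological groups. -/
  isEmbedding : ∀ P : ModPair.{u}, P.IsFree → IsEmbedding (w.app P).hom
  /-- `W` preserves reflexive coequalisers. -/
  preservesReflexive : ∀ {A B : ModPair.{u}} (f g : A ⟶ B), IsReflexivePair f g →
    PreservesColimit (parallelPair f g) W

end Cosets

end

end GWitt

/-!
# Witt vectors with coefficients for profinite groups

The proof has three parts.

*The image of the ghost map of a free object.* Let `(T; Q) = (ℤ[X]; ℤ[X](Y))`. A tensor power of
`Q` is the free abelian group on the elements `b = r • ⨂ y_i` with `r` a monomial and `y_i`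
generators. On such an element the contribution of `V ∈ S` to the ghost map does not depend on the
representatives of `G / V` (`tau_tprod`); let `theta V` be its additive extension to `Q^{⊗ G/V}`.
The ghost map has image `ghostSpan`, the closure of the subgroup of `∏_{U ∈ S} Q^{⊗ G/U}`
generated by the values of all `theta V`, which involves no choices.

For one inclusion, let `n = ∑ b_i`. The component at `U` of the contribution of `V` is then a
weighted count of the `U`-fixed points of an `H`-set, whose elements are the cosets `kV` together
with a colouring of `V k⁻¹` by the indices `i` (`tau_sum`). The orbit with stabiliser `W`
contributes a value of `theta W` (`theta_orbit`), whence `weighted_mem_ghostSpan`. An arbitrary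
`n` is a difference `p - q` of such sums; as the contribution of `p + t q` is polynomial in `t ∈
ℤ`, its value at `t = -1` is an integral combination of its values at `t ≥ 0`
(`tau_mem_ghostSpan`).

For the other inclusion the coordinates `n_V` are found by recursion on the index of `V`. At each
step a family in `ghostSpan` that vanishes at all proper overgroups of `V` has to be a trace over
the Weyl group at `V` (`Choices.exists_theta_eq`). This holds because an element of trace zero has
vanishing `theta` (`theta_eq_zero_of_self`): `theta` is invariant under the Weyl group and its
values lie in torsion-free groups. Since `n_V` depends on finitely many components only, the
recursion defines a continuous section of the ghost map (`Choices.ghostSection`), so that the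
ghost map is a topological quotient map onto its image.

*Existence.* Every `P = (R; M)` has a functorial free cover `cover P = (ℤ[R]; ℤ[R](M))`. The Witt
vectors of `P` are the image of the ghost map of `cover P` modulo the closure of the subgroup
generated by the differences `w a - w b`, for coordinates `a` and `b` with the same image in `P`.
If `P` is free then the cover splits, and the splitting embeds the Witt vectors of `P` into the
image of the ghost map of `cover P`. Reflexive coequalisers are preserved because a reflexive pair
in `Mod` extends to a fork that is exact on underlying sets (`exists_exactFork`), and tensor
powers preserve exact forks (`ExactFork.tpow_exact`).

*Uniqueness.* On free objects two Witt vector functors embed into the ghost group with the same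
image `ghostSpan`, which gives a unique comparison. It extends to all `P`, because `P` is the
reflexive coequaliser of the kernel pair of `cover P ⟶ P`, which is in turn covered by a free
object.
-/

set_option linter.unusedSectionVars false

namespace GWitt

noncomputable section

/-! ### Polynomial functions on the integers -/

section IsPoly

variable {A B : Type*} [AddCommGroup A] [AddCommGroup B]

/-- A function `ℤ → A` is polynomial if all its finite differences of sufficiently high order
vanish. -/
def IsPoly (g : ℤ → A) : Prop :=
  ∃ N : ℕ, ∀ n ≥ N, ∀ y, (fwdDiff (1 : ℤ))^[n] g y = 0

theorem IsPoly.comp {g : ℤ → A} (hg : IsPoly g) (φ : A →+ B) : IsPoly (fun t => φ (g t)) := by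
  obtain ⟨N, hN⟩ := hg
  refine ⟨N, fun n hn y => ?_⟩
  have := congrArg φ (hN n hn y)
  rw [fwdDiff_iter_eq_sum_shift] at this ⊢
  simpa [map_sum, map_zsmul] using this

theorem IsPoly.sum {ι : Type*} (s : Finset ι) {g : ι → ℤ → A} (hg : ∀ i ∈ s, IsPoly (g i)) :
    IsPoly (fun t => ∑ i ∈ s, g i t) := by
  choose! N hN using hg
  refine ⟨s.sup N, fun n hn y => ?_⟩
  have : (fun t => ∑ i ∈ s, g i t) = ∑ i ∈ s, g i := by
    funext t
    simp
  rw [this, fwdDiff_iter_finsetSum, Finset.sum_apply]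
  exact Finset.sum_eq_zero fun i hi => hN i hi n ((Finset.le_sup hi).trans hn) y

theorem isPoly_pow_smul (k : ℕ) (a : A) : IsPoly (fun t : ℤ => t ^ k • a) := by
  have : IsPoly (fun t : ℤ => t ^ k) :=
    ⟨k + 1, fun n hn y => by rw [fwdDiff_iter_pow_eq_zero_of_lt (by omega)]; rfl⟩
  exact this.comp ((zmultiplesHom A a))

/-- The value at `-1` of polynomial functions is one and the same integral combination of their
values at natural numbers. -/
theorem IsPoly.exists_extrapolation {ι : Type*} {A : ι → Type*} [∀ i, AddCommGroup (A i)]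
    (s : Finset ι) (g : ∀ i, ℤ → A i) (hg : ∀ i ∈ s, IsPoly (g i)) :
    ∃ (N : ℕ) (c : ℕ → ℤ), ∀ i ∈ s, g i (-1) = ∑ k ∈ Finset.range N, c k • g i k := by
  choose! N hN using hg
  refine ⟨s.sup N, fun k => - ((-1) ^ (s.sup N) * ((-1) ^ (s.sup N - (k + 1)) *
    (s.sup N).choose (k + 1))), fun i hi => ?_⟩
  have := hN i hi (s.sup N) (Finset.le_sup hi) (-1)
  rw [fwdDiff_iter_eq_sum_shift, Finset.sum_range_succ'] at this
  have h2 := congrArg (fun z => ((-1 : ℤ) ^ (s.sup N)) • z) this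
  simp only [smul_add, Finset.smul_sum, smul_smul, smul_zero] at h2
  have h3 : (-1 : ℤ) ^ (s.sup N) * ((-1) ^ (s.sup N - 0) * ((s.sup N).choose 0 : ℤ)) = 1 := by
    simp [← mul_pow]
  rw [h3, one_smul] at h2
  have h4 : (-1 : ℤ) + 0 • 1 = -1 := by simp
  rw [h4] at h2
  rw [eq_neg_of_add_eq_zero_right h2, ← Finset.sum_neg_distrib]
  refine Finset.sum_congr rfl fun k _ => ?_
  rw [neg_smul]
  congr 3
  simp

end IsPoly

/-! ### Tensor powers of sums -/

section TPow

variable {P Q : ModPair.{u}} {X Y : Type u}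

/-- Every tensor is a finite sum of scaled pure tensors. -/
theorem TPow.exists_sum (z : TPow P X) : ∃ (ι : Type) (_ : Fintype ι) (r : ι → P.ring)
    (m : ι → X → P.mod), z = ∑ i, r i • TPow.tprod P (m i) := by
  induction z using TPow.induction with
  | smul r m => exact ⟨Unit, inferInstance, fun _ => r, fun _ => m, by simp⟩
  | add a b ha hb =>
    obtain ⟨ι, _, r, m, rfl⟩ := ha
    obtain ⟨κ, _, r', m', rfl⟩ := hb
    exact ⟨ι ⊕ κ, inferInstance, Sum.elim r r', Sum.elim m m', by simp⟩

theorem TPow.pow_sum_smul {ι : Type*} [Fintype ι] [Fintype Y] [DecidableEq Y] (r : ι → P.ring)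
    (v : ι → TPow P X) :
    TPow.pow Y (∑ i, r i • v i) =
      ∑ F : Y → ι, (∏ s, r (F s)) • TPow.nested P X Y (fun s => v (F s)) := by
  rw [TPow.pow, MultilinearMap.map_sum]
  exact Finset.sum_congr rfl fun F _ => MultilinearMap.map_smul_univ _ _ _

theorem TPow.pow_sum_tprod {ι : Type*} [Fintype ι] [Fintype Y] [DecidableEq Y] (r : ι → P.ring)
    (m : ι → X → P.mod) :
    TPow.pow Y (∑ i, r i • TPow.tprod P (m i)) =
      ∑ F : Y → ι, (∏ s, r (F s)) • TPow.tprod P (fun p : X × Y => m (F p.2) p.1) := by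
  rw [TPow.pow_sum_smul]
  refine Finset.sum_congr rfl fun F _ => ?_
  rw [← TPow.nested_tprod]

theorem TPow.map_pow [Finite Y] (f : P ⟶ Q) (n : TPow P X) :
    TPow.map _ f (TPow.pow Y n) = TPow.pow Y (TPow.map X f n) := by
  classical
  cases nonempty_fintype Y
  obtain ⟨ι, _, r, m, rfl⟩ := TPow.exists_sum n
  simp only [TPow.pow_sum_tprod, map_sum, LinearMap.map_smulₛₗ, TPow.map_tprod, map_prod]

theorem TPow.isPoly_pow [Finite Y] (p q : TPow P X) :
    IsPoly (fun t : ℤ => TPow.pow Y (p + t • q)) := by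
  classical
  cases nonempty_fintype Y
  have h : ∀ t : ℤ, p + t • q
      = ∑ b : Bool, (bif b then (t : P.ring) else 1) • (bif b then q else p) := by
    intro t
    simp [add_comm, Int.cast_smul_eq_zsmul]
  have h2 : ∀ (t : ℤ) (F : Y → Bool), ∏ s, (bif F s then (t : P.ring) else 1)
      = ((t ^ (Finset.univ.filter fun s => F s = true).card : ℤ) : P.ring) := by
    intro t F
    rw [Int.cast_pow, ← Finset.prod_const, Finset.prod_filter]
    exact Finset.prod_congr rfl fun s _ => by cases F s <;> rfl
  simp only [h, TPow.pow_sum_smul, h2, Int.cast_smul_eq_zsmul]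
  exact IsPoly.sum _ fun F _ => isPoly_pow_smul _ _

end TPow

/-! ### Exact forks of modules -/

section Fork

/-- A fork `A ⇉ B → C` in `Mod` which is exact on underlying sets: `p` is surjective, and `A`
surjects onto the kernel pair of `p`, both for the rings and for the modules. -/
structure ExactFork {A B C : ModPair.{u}} (f g : A ⟶ B) (p : B ⟶ C) : Prop where
  w : f ≫ p = g ≫ p
  ring_surj : Function.Surjective p.ringHom
  mod_surj : Function.Surjective p.modHom
  ring_exact : ∀ x y, p.ringHom x = p.ringHom y → ∃ a, f.ringHom a = x ∧ g.ringHom a = y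
  mod_exact : ∀ x y, p.modHom x = p.modHom y → ∃ a, f.modHom a = x ∧ g.modHom a = y

variable {A B C : ModPair.{u}} {f g : A ⟶ B} {p : B ⟶ C}

theorem TPow.map_surjective {X : Type u} (hr : Function.Surjective p.ringHom)
    (hm : Function.Surjective p.modHom) : Function.Surjective (TPow.map X p) := by
  intro z
  induction z using TPow.induction with
  | smul r m =>
    obtain ⟨r, rfl⟩ := hr r
    choose m' hm' using fun x => hm (m x)
    exact ⟨r • TPow.tprod B m', by rw [LinearMap.map_smulₛₗ, TPow.map_tprod]; simp only [hm']⟩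
  | add a b ha hb =>
    obtain ⟨a, rfl⟩ := ha
    obtain ⟨b, rfl⟩ := hb
    exact ⟨a + b, map_add _ _ _⟩

/-- The tensor power functors preserve exact forks. The differences `f a - g a` form a subgroup `L`
of the tensor power of `B`; arbitrary lifts of scalars and vectors from `C` to `B` define an
additive map from the tensor power of `C` to the quotient by `L`, which shows that `L` is the whole
kernel. -/
theorem ExactFork.tpow_exact (h : ExactFork f g p) {X : Type u} (x y : TPow B X)
    (hxy : TPow.map X p x = TPow.map X p y) :
    ∃ a, TPow.map X f a = x ∧ TPow.map X g a = y := by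
  classical
  let L : AddSubgroup (TPow B X) :=
    ((TPow.map X f).toAddMonoidHom - (TPow.map X g).toAddMonoidHom).range
  have hL : ∀ (r r' : B.ring) (m m' : X → B.mod), p.ringHom r = p.ringHom r' →
      (∀ x, p.modHom (m x) = p.modHom (m' x)) →
      (QuotientAddGroup.mk (r • TPow.tprod B m) : TPow B X ⧸ L)
        = QuotientAddGroup.mk (r' • TPow.tprod B m') := by
    intro r r' m m' hr hm
    obtain ⟨a, rfl, rfl⟩ := h.ring_exact _ _ hr
    choose b hb hb' using fun x => h.mod_exact _ _ (hm x)
    obtain rfl : (fun x => f.modHom (b x)) = m := funext hb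
    obtain rfl : (fun x => g.modHom (b x)) = m' := funext hb'
    rw [eq_comm, QuotientAddGroup.eq]
    refine ⟨a • TPow.tprod A b, ?_⟩
    change TPow.map X f _ - TPow.map X g _ = _
    simp only [LinearMap.map_smulₛₗ, TPow.map_tprod]
    abel
  obtain ⟨sr, hsr⟩ := h.ring_surj.hasRightInverse
  obtain ⟨sm, hsm⟩ := h.mod_surj.hasRightInverse
  have key : ∀ (m : X → C.mod) (i : X) (c : B.mod) (x : X),
      p.modHom (sm (Function.update m i (p.modHom c) x))
        = p.modHom (Function.update (fun x => sm (m x)) i c x) := by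
    intro m i c x
    rw [hsm]
    by_cases hx : x = i
    · subst hx; simp
    · simp [hx, hsm (m x)]
  -- the additive map `TPow C X → TPow B X ⧸ L` obtained by lifting scalars and vectors
  -- the five conditions follow from `hL`, as both sides are lifts of the same data
  let Ψ : TPow C X →+ TPow B X ⧸ L := PiTensorProduct.liftAddHom
    (fun q => QuotientAddGroup.mk (sr q.1 • TPow.tprod B fun x => sm (q.2 x)))
    (by
      intro r m i hi
      rw [hL (sr r) (sr r) _ (Function.update (fun x => sm (m x)) i 0) rfl,
        MultilinearMap.map_update_zero]
      · simp
      · intro x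
        rw [hsm]
        by_cases hx : x = i
        · subst hx; simp [hi]
        · simp [hx, hsm (m x)])
    (by
      intro m
      rw [hL _ 0 _ (fun x => sm (m x)) (by rw [hsr, map_zero]) fun _ => rfl]
      simp)
    (by
      intro inst r m i a b
      obtain rfl : inst = fun a b => Classical.propDecidable _ := Subsingleton.elim _ _
      obtain ⟨a, rfl⟩ := h.mod_surj a
      obtain ⟨b, rfl⟩ := h.mod_surj b
      dsimp only
      rw [← map_add, hL _ (sr r) _ _ rfl (key m i a), hL _ (sr r) _ _ rfl (key m i b),
        hL _ (sr r) _ _ rfl (key m i (a + b)), MultilinearMap.map_update_add, smul_add,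
        QuotientAddGroup.mk_add])
    (by
      intro r r' m
      rw [← QuotientAddGroup.mk_add, ← add_smul]
      exact hL _ _ _ _ (by rw [map_add, hsr, hsr, hsr]) fun _ => rfl)
    (by
      intro inst r m i r'
      obtain rfl : inst = fun a b => Classical.propDecidable _ := Subsingleton.elim _ _
      have h1 : r' • m i = p.modHom (sr r' • sm (m i)) := by
        rw [LinearMap.map_smulₛₗ, hsr, hsm]
      dsimp only
      rw [h1, hL _ (sr r) _ _ rfl (key m i _), MultilinearMap.map_update_smul,
        Function.update_eq_self, smul_smul]
      exact hL _ _ _ _ (by rw [map_mul, hsr, hsr, hsr, mul_comm]) fun _ => rfl)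
  have hΨ : ∀ z : TPow B X, Ψ (TPow.map X p z) = QuotientAddGroup.mk z := by
    intro z
    induction z using TPow.induction with
    | smul r m =>
      rw [LinearMap.map_smulₛₗ, TPow.map_tprod]
      have : Ψ (p.ringHom r • TPow.tprod C fun x => p.modHom (m x))
          = QuotientAddGroup.mk (sr (p.ringHom r) • TPow.tprod B fun x => sm (p.modHom (m x))) := by
        exact congrArg Ψ (PiTensorProduct.tprodCoeff_eq_smul_tprod (R := C.ring) (p.ringHom r)
          fun x => p.modHom (m x)).symm
      rw [this]
      exact hL _ _ _ _ (hsr _) fun x => hsm _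
    | add a b ha hb => rw [map_add, map_add, ha, hb, QuotientAddGroup.mk_add]
  -- every tensor is the image of one and the same element under `f` and `g`
  have hdiag : ∀ z : TPow B X, ∃ a, TPow.map X f a = z ∧ TPow.map X g a = z := by
    intro z
    induction z using TPow.induction with
    | smul r m =>
      obtain ⟨a, ha, ha'⟩ := h.ring_exact r r rfl
      choose b hb hb' using fun x => h.mod_exact _ _ (rfl : p.modHom (m x) = p.modHom (m x))
      exact ⟨a • TPow.tprod A b, by simp only [LinearMap.map_smulₛₗ, TPow.map_tprod, ha, hb],
        by simp only [LinearMap.map_smulₛₗ, TPow.map_tprod, ha', hb']⟩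
    | add a b ha hb =>
      obtain ⟨c, rfl, hc⟩ := ha
      obtain ⟨d, rfl, hd⟩ := hb
      exact ⟨c + d, map_add _ _ _, by rw [map_add, hc, hd]⟩
  have := congrArg Ψ hxy
  rw [hΨ, hΨ, eq_comm, QuotientAddGroup.eq] at this
  obtain ⟨a, ha⟩ := this
  change TPow.map X f a - TPow.map X g a = -y + x at ha
  obtain ⟨d, hd, hd'⟩ := hdiag (y - TPow.map X g a)
  refine ⟨a + d, ?_, ?_⟩
  · rw [map_add, hd]
    have : TPow.map X f a = -y + x + TPow.map X g a := by rw [← ha]; abel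
    rw [this]; abel
  · rw [map_add, hd']; abel

end Fork

/-! ### Coequalisers and free objects in the category of modules -/

section ModPair

variable {A B C D : ModPair.{u}}

@[simp] theorem ModPair.id_ringHom (r : A.ring) : (𝟙 A : A ⟶ A).ringHom r = r := rfl

theorem ModPair.id_modHom (m : A.mod) : (𝟙 A : A ⟶ A).modHom m = m := rfl

@[simp] theorem ModPair.comp_ringHom (f : A ⟶ B) (g : B ⟶ C) (r : A.ring) :
    (f ≫ g).ringHom r = g.ringHom (f.ringHom r) := rfl

theorem ModPair.comp_modHom (f : A ⟶ B) (g : B ⟶ C) (m : A.mod) :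
    (f ≫ g).modHom m = g.modHom (f.modHom m) := rfl

theorem ModPair.hom_ext {f g : A ⟶ B} (hr : ∀ r, f.ringHom r = g.ringHom r)
    (hm : ∀ m, f.modHom m = g.modHom m) : f = g := by
  obtain ⟨f, f'⟩ := f
  obtain ⟨g, g'⟩ := g
  obtain rfl : f = g := RingHom.ext hr
  obtain rfl : f' = g' := LinearMap.ext hm
  rfl

/-- A morphism of `Mod` from plain maps with the required compatibilities. -/
def ModPair.mkHom (φ : A.ring →+* B.ring) (ψ : A.mod →+ B.mod)
    (h : ∀ (r : A.ring) (m : A.mod), ψ (r • m) = φ r • ψ m) : A ⟶ B :=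
  ⟨φ, { ψ with map_smul' := h }⟩

theorem ExactFork.exists_desc {f g : A ⟶ B} {p : B ⟶ C} (h : ExactFork f g p) (k : B ⟶ D)
    (hk : f ≫ k = g ≫ k) : ∃ l : C ⟶ D, p ≫ l = k := by
  have hr : ∀ x y, p.ringHom x = p.ringHom y → k.ringHom x = k.ringHom y := by
    intro x y hxy
    obtain ⟨a, rfl, rfl⟩ := h.ring_exact x y hxy
    rw [← ModPair.comp_ringHom, ← ModPair.comp_ringHom, hk]
  have hm : ∀ x y, p.modHom x = p.modHom y → k.modHom x = k.modHom y := by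
    intro x y hxy
    obtain ⟨a, rfl, rfl⟩ := h.mod_exact x y hxy
    rw [← ModPair.comp_modHom, ← ModPair.comp_modHom, hk]
  obtain ⟨sr, hsr⟩ := h.ring_surj.hasRightInverse
  obtain ⟨sm, hsm⟩ := h.mod_surj.hasRightInverse
  let φ : C.ring →+* D.ring :=
    { toFun := fun r => k.ringHom (sr r)
      map_one' := by rw [← map_one k.ringHom]; exact hr _ _ (by simp [hsr 1])
      map_zero' := by rw [← map_zero k.ringHom]; exact hr _ _ (by simp [hsr 0])
      map_mul' := fun a b => by
        rw [← map_mul k.ringHom]; exact hr _ _ (by rw [map_mul, hsr, hsr, hsr])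
      map_add' := fun a b => by
        rw [← map_add k.ringHom]; exact hr _ _ (by rw [map_add, hsr, hsr, hsr]) }
  let ψ : C.mod →+ D.mod :=
    { toFun := fun r => k.modHom (sm r)
      map_zero' := by rw [← map_zero k.modHom]; exact hm _ _ (by simp [hsm 0])
      map_add' := fun a b => by
        rw [← map_add k.modHom]; exact hm _ _ (by rw [map_add, hsm, hsm, hsm]) }
  refine ⟨ModPair.mkHom φ ψ fun r m => ?_, ModPair.hom_ext (fun r => hr _ _ (hsr _))
    fun m => hm _ _ (hsm _)⟩
  change k.modHom _ = k.ringHom _ • k.modHom _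
  rw [← LinearMap.map_smulₛₗ]
  exact hm _ _ (by rw [LinearMap.map_smulₛₗ, hsm, hsm, hsr])

/-- The target of an exact fork is a coequaliser. -/
def ExactFork.isColimit {f g : A ⟶ B} {p : B ⟶ C} (h : ExactFork f g p) :
    IsColimit (Cofork.ofπ p h.w) :=
  Cofork.IsColimit.mk _ (fun s => (h.exists_desc s.π s.condition).choose)
    (fun s => (h.exists_desc s.π s.condition).choose_spec)
    (fun s m hm => by
      have h1 : p ≫ m = p ≫ (h.exists_desc s.π s.condition).choose :=
        hm.trans (h.exists_desc s.π s.condition).choose_spec.symm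
      refine ModPair.hom_ext (fun r => ?_) fun x => ?_
      · obtain ⟨r, rfl⟩ := h.ring_surj r
        exact congrArg (fun q : B ⟶ _ => q.ringHom r) h1
      · obtain ⟨x, rfl⟩ := h.mod_surj x
        exact congrArg (fun q : B ⟶ _ => q.modHom x) h1)

/-- Every reflexive pair in `Mod` extends to an exact fork: because of the common section, the
differences `f a - g a` already form an ideal, respectively a submodule. -/
theorem exists_exactFork (f g : A ⟶ B) [IsReflexivePair f g] :
    ∃ (C : ModPair.{u}) (p : B ⟶ C), ExactFork f g p := by
  obtain ⟨s, hsf, hsg⟩ := IsReflexivePair.common_section (f := f) (g := g)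
  have hf : ∀ r, f.ringHom (s.ringHom r) = r := fun r =>
    congrArg (fun q : B ⟶ B => q.ringHom r) hsf
  have hg : ∀ r, g.ringHom (s.ringHom r) = r := fun r =>
    congrArg (fun q : B ⟶ B => q.ringHom r) hsg
  have hf' : ∀ r, f.modHom (s.modHom r) = r := fun r =>
    congrArg (fun q : B ⟶ B => q.modHom r) hsf
  have hg' : ∀ r, g.modHom (s.modHom r) = r := fun r =>
    congrArg (fun q : B ⟶ B => q.modHom r) hsg
  let J : Ideal B.ring :=
    { carrier := {x | ∃ a, f.ringHom a - g.ringHom a = x}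
      zero_mem' := ⟨0, by simp⟩
      add_mem' := by
        rintro _ _ ⟨a, rfl⟩ ⟨b, rfl⟩
        exact ⟨a + b, by simp only [map_add]; ring⟩
      smul_mem' := by
        rintro r _ ⟨a, rfl⟩
        exact ⟨s.ringHom r * a, by simp only [map_mul, hf, hg, smul_eq_mul]; ring⟩ }
  let N : Submodule B.ring B.mod :=
    { carrier := {x | ∃ a, f.modHom a - g.modHom a = x}
      zero_mem' := ⟨0, by simp⟩
      add_mem' := by
        rintro _ _ ⟨a, rfl⟩ ⟨b, rfl⟩
        exact ⟨a + b, by simp only [map_add]; abel⟩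
      smul_mem' := by
        rintro r _ ⟨a, rfl⟩
        exact ⟨s.ringHom r • a, by simp only [LinearMap.map_smulₛₗ, hf, hg, smul_sub]⟩ }
  have htors : Module.IsTorsionBySet B.ring (B.mod ⧸ N) (J : Set B.ring) := by
    rintro x ⟨_, a, rfl⟩
    obtain ⟨m, rfl⟩ := Submodule.Quotient.mk_surjective N x
    change Submodule.Quotient.mk ((f.ringHom a - g.ringHom a) • m) = _
    rw [Submodule.Quotient.mk_eq_zero]
    exact ⟨a • s.modHom m, by simp only [LinearMap.map_smulₛₗ, hf', hg', sub_smul]⟩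
  let : Module (B.ring ⧸ J) (B.mod ⧸ N) := htors.module
  let C : ModPair.{u} := { ring := B.ring ⧸ J, mod := B.mod ⧸ N }
  let p : B ⟶ C := ModPair.mkHom (B := C) (Ideal.Quotient.mk J) N.mkQ.toAddMonoidHom
    (fun r m => rfl)
  refine ⟨C, p, ⟨?_, Ideal.Quotient.mk_surjective, Submodule.Quotient.mk_surjective N, ?_, ?_⟩⟩
  · refine ModPair.hom_ext (fun r => ?_) fun m => ?_
    · exact Ideal.Quotient.eq.mpr ⟨r, rfl⟩
    · exact (Submodule.Quotient.eq N).mpr ⟨m, rfl⟩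
  · intro x y hxy
    obtain ⟨a, ha⟩ : x - y ∈ J := Ideal.Quotient.eq.mp hxy
    refine ⟨a + s.ringHom (y - g.ringHom a), ?_, ?_⟩
    · rw [map_add, hf]; linear_combination ha
    · rw [map_add, hg]; ring
  · intro x y hxy
    obtain ⟨a, ha⟩ : x - y ∈ N := (Submodule.Quotient.eq N).mp hxy
    refine ⟨a + s.modHom (y - g.modHom a), ?_, ?_⟩
    · rw [map_add, hf', ← sub_eq_zero, ← sub_eq_zero.mpr ha]; abel
    · rw [map_add, hg']; abel

/-- The kernel pair of a morphism `p` of `Mod`. -/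
def kernelPair (p : B ⟶ C) : ModPair.{u} :=
  letI R : Subring (B.ring × B.ring) :=
    RingHom.eqLocus (p.ringHom.comp (RingHom.fst _ _)) (p.ringHom.comp (RingHom.snd _ _))
  letI M : AddSubgroup (B.mod × B.mod) :=
    AddMonoidHom.eqLocus (p.modHom.toAddMonoidHom.comp (AddMonoidHom.fst _ _))
      (p.modHom.toAddMonoidHom.comp (AddMonoidHom.snd _ _))
  letI : SMul R M := ⟨fun r m => ⟨(r.1.1 • m.1.1, r.1.2 • m.1.2), by
    have hr : p.ringHom r.1.1 = p.ringHom r.1.2 := r.2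
    have hm : p.modHom m.1.1 = p.modHom m.1.2 := m.2
    change p.modHom (r.1.1 • m.1.1) = p.modHom (r.1.2 • m.1.2)
    rw [LinearMap.map_smulₛₗ, LinearMap.map_smulₛₗ, hr, hm]⟩⟩
  { ring := R
    mod := M
    module :=
      { one_smul := fun m => Subtype.ext (Prod.ext (one_smul _ _) (one_smul _ _))
        mul_smul := fun _ _ m => Subtype.ext (Prod.ext (mul_smul _ _ _) (mul_smul _ _ _))
        smul_zero := fun _ => Subtype.ext (Prod.ext (smul_zero _) (smul_zero _))
        smul_add := fun _ _ m => Subtype.ext (Prod.ext (smul_add _ _ _) (smul_add _ _ _))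
        add_smul := fun _ _ m => Subtype.ext (Prod.ext (add_smul _ _ _) (add_smul _ _ _))
        zero_smul := fun _ => Subtype.ext (Prod.ext (zero_smul _ _) (zero_smul _ _)) } }

/-- The first projection of the kernel pair. -/
def kernelPair.fst (p : B ⟶ C) : kernelPair p ⟶ B :=
  ModPair.mkHom (A := kernelPair p) ((RingHom.fst _ _).comp (Subring.subtype _))
    ((AddMonoidHom.fst _ _).comp (AddSubgroup.subtype _)) fun _ _ => rfl

/-- The second projection of the kernel pair. -/
def kernelPair.snd (p : B ⟶ C) : kernelPair p ⟶ B :=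
  ModPair.mkHom (A := kernelPair p) ((RingHom.snd _ _).comp (Subring.subtype _))
    ((AddMonoidHom.snd _ _).comp (AddSubgroup.subtype _)) fun _ _ => rfl

theorem kernelPair.isReflexivePair (p : B ⟶ C) :
    IsReflexivePair (kernelPair.fst p) (kernelPair.snd p) := by
  refine ⟨⟨ModPair.mkHom (B := kernelPair p)
    (((RingHom.id B.ring).prod (RingHom.id B.ring)).codRestrict _ fun r => rfl)
    (((AddMonoidHom.id B.mod).prod (AddMonoidHom.id B.mod)).codRestrict _ fun m => rfl)
    fun r m => rfl, ?_, ?_⟩⟩ <;>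
  exact ModPair.hom_ext (fun r => rfl) fun m => rfl

theorem kernelPair.exactFork (p : B ⟶ C) (hr : Function.Surjective p.ringHom)
    (hm : Function.Surjective p.modHom) :
    ExactFork (kernelPair.fst p) (kernelPair.snd p) p where
  w := ModPair.hom_ext (fun r => r.2) fun m => m.2
  ring_surj := hr
  mod_surj := hm
  ring_exact x y h := ⟨⟨(x, y), h⟩, rfl, rfl⟩
  mod_exact x y h := ⟨⟨(x, y), h⟩, rfl, rfl⟩

variable {X Y : Type u}

/-- The generator `x` of the ring of `freeModPair X Y`. -/
def freeX (Y : Type u) (x : X) : (freeModPair X Y).ring := (MvPolynomial.X x : MvPolynomial X ℤ)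

/-- The generator `y` of the module of `freeModPair X Y`. -/
def freeY (X : Type u) (y : Y) : (freeModPair X Y).mod :=
  (Finsupp.single y 1 : Y →₀ MvPolynomial X ℤ)

/-- The morphism out of a free object with prescribed values on generators. -/
def freeLift (a : X → A.ring) (b : Y → A.mod) : freeModPair X Y ⟶ A :=
  letI φ : MvPolynomial X ℤ →+* A.ring := MvPolynomial.eval₂Hom (Int.castRingHom A.ring) a
  letI : Module (MvPolynomial X ℤ) A.mod := Module.compHom _ φ
  letI ψ : (Y →₀ MvPolynomial X ℤ) →ₗ[MvPolynomial X ℤ] A.mod := Finsupp.linearCombination _ b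
  ModPair.mkHom (A := freeModPair X Y) φ ψ.toAddMonoidHom fun r m => ψ.map_smul r m

@[simp] theorem freeLift_X (a : X → A.ring) (b : Y → A.mod) (x : X) :
    (freeLift a b).ringHom (freeX Y x) = a x :=
  MvPolynomial.eval₂Hom_X' _ _ _

theorem freeLift_Y (a : X → A.ring) (b : Y → A.mod) (y : Y) :
    (freeLift a b).modHom (freeY X y) = b y := by
  let φ : MvPolynomial X ℤ →+* A.ring := MvPolynomial.eval₂Hom (Int.castRingHom A.ring) a
  let : Module (MvPolynomial X ℤ) A.mod := Module.compHom _ φ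
  refine (Finsupp.linearCombination_single (MvPolynomial X ℤ) _ _).trans ?_
  exact one_smul _ _

theorem free_hom_ext {f g : freeModPair X Y ⟶ A}
    (hX : ∀ x, f.ringHom (freeX Y x) = g.ringHom (freeX Y x))
    (hY : ∀ y, f.modHom (freeY X y) = g.modHom (freeY X y)) : f = g := by
  have hr : f.ringHom = g.ringHom :=
    MvPolynomial.ringHom_ext (A := A.ring) (f := f.ringHom) (g := g.ringHom)
      (fun n => (congrFun (congrArg DFunLike.coe (Subsingleton.elim
        (f.ringHom.comp MvPolynomial.C) (g.ringHom.comp MvPolynomial.C))) n)) hX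
  refine ModPair.hom_ext (fun r => by rw [hr]) fun m => ?_
  induction m using Finsupp.induction_linear with
  | zero => exact (map_zero f.modHom).trans (map_zero g.modHom).symm
  | add a b ha hb =>
    exact (map_add f.modHom a b).trans ((congrArg₂ _ ha hb).trans (map_add g.modHom a b).symm)
  | single y r =>
    have hs : (Finsupp.single y r : Y →₀ MvPolynomial X ℤ)
        = HSMul.hSMul (α := (freeModPair X Y).ring) (β := (freeModPair X Y).mod) r (freeY X y) := by
      refine Eq.trans ?_ (Finsupp.smul_single' _ _ _).symm
      rw [mul_one]
    have key (k : freeModPair X Y ⟶ A) : k.modHom (Finsupp.single y r : Y →₀ MvPolynomial X ℤ)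
        = k.ringHom r • k.modHom (freeY X y) :=
      (congrArg k.modHom hs).trans (LinearMap.map_smulₛₗ k.modHom _ _)
    exact (key f).trans ((congrArg₂ (fun (a : A.ring) (b : A.mod) => a • b)
      (DFunLike.congr_fun hr _) (hY y)).trans (key g).symm)

/-- The canonical free object over `P`, generated by all elements of `P`. -/
abbrev cover (P : ModPair.{u}) : ModPair.{u} := freeModPair P.ring P.mod

/-- The counit `cover P ⟶ P`. -/
def cover.ε (P : ModPair.{u}) : cover P ⟶ P := freeLift id id

/-- Functoriality of the canonical free cover. -/
def cover.map (f : A ⟶ B) : cover A ⟶ cover B :=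
  freeLift (fun r => freeX _ (f.ringHom r)) (fun m => freeY _ (f.modHom m))

theorem cover.ε_Y (P : ModPair.{u}) (m : P.mod) : (cover.ε P).modHom (freeY _ m) = m :=
  freeLift_Y _ _ _

theorem cover.map_Y (f : A ⟶ B) (m : A.mod) :
    (cover.map f).modHom (freeY _ m) = freeY _ (f.modHom m) :=
  freeLift_Y _ _ _

theorem cover.map_ε (f : A ⟶ B) : cover.map f ≫ cover.ε B = cover.ε A ≫ f :=
  free_hom_ext (by simp [cover.map, cover.ε]) fun y => by
    rw [ModPair.comp_modHom, ModPair.comp_modHom, cover.map_Y, cover.ε_Y, cover.ε_Y]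

theorem cover.map_id (A : ModPair.{u}) : cover.map (𝟙 A) = 𝟙 _ :=
  free_hom_ext (by simp [cover.map]) fun y => by
    rw [cover.map_Y, ModPair.id_modHom, ModPair.id_modHom]

theorem cover.map_comp (f : A ⟶ B) (g : B ⟶ C) :
    cover.map (f ≫ g) = cover.map f ≫ cover.map g :=
  free_hom_ext (by simp [cover.map]) fun y => by
    rw [ModPair.comp_modHom, cover.map_Y, cover.map_Y, cover.map_Y, ModPair.comp_modHom]

theorem cover.ε_ring_surjective (P : ModPair.{u}) : Function.Surjective (cover.ε P).ringHom :=
  fun r => ⟨freeX _ r, freeLift_X _ _ _⟩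

theorem cover.ε_mod_surjective (P : ModPair.{u}) : Function.Surjective (cover.ε P).modHom :=
  fun m => ⟨freeY _ m, cover.ε_Y P m⟩

/-- Free objects are projective with respect to surjective morphisms. -/
theorem exists_free_lift {p : B ⟶ C} (hr : Function.Surjective p.ringHom)
    (hm : Function.Surjective p.modHom) (k : freeModPair X Y ⟶ C) :
    ∃ l : freeModPair X Y ⟶ B, l ≫ p = k := by
  choose sr hsr using hr
  choose sm hsm using hm
  exact ⟨freeLift (fun x => sr (k.ringHom (freeX Y x))) (fun y => sm (k.modHom (freeY X y))),
    free_hom_ext (by simp [hsr]) fun y => by rw [ModPair.comp_modHom, freeLift_Y, hsm]⟩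

end ModPair

/-! ### Fixed cosets and the summands of the ghost map -/

section Cosets

variable {G : Type u} [Group G] [TopologicalSpace G] [IsTopologicalGroup G]

theorem conj_conj (g h : G) (V : OpenSubgroup G) : conj g (conj h V) = conj (g * h) V := by
  ext
  simp [mem_conj, mul_assoc]

theorem conj_one (V : OpenSubgroup G) : conj 1 V = V := by
  ext
  simp [mem_conj]

theorem conj_mono {U V : OpenSubgroup G} (g : G) (h : U ≤ V) : conj g U ≤ conj g V :=
  fun _ hx => mem_conj.mpr (h (mem_conj.mp hx))

theorem index_conj (g : G) (V : OpenSubgroup G) :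
    (conj g V).toSubgroup.index = V.toSubgroup.index :=
  Subgroup.index_comap_of_surjective _ (MulAut.conj g⁻¹).surjective

theorem smul_mk_eq_mk_one {V : OpenSubgroup G} {y k : G} :
    y • (QuotientGroup.mk k : Cosets V) = QuotientGroup.mk 1 ↔ y * k ∈ V := by
  change (QuotientGroup.mk (y * k) : Cosets V) = _ ↔ _
  rw [eq_comm, QuotientGroup.eq]
  simp

/-- The `U`-fixed cosets in `G / V` that have a representative in `H`. -/
def fixedSet (H V U : OpenSubgroup G) : Set (Cosets V) :=
  {z | (∃ k ∈ H, (QuotientGroup.mk k : Cosets V) = z) ∧ ∀ u ∈ U, u • z = z}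

theorem mk_mem_fixedSet {H V U : OpenSubgroup G} {k : G} (hk : k ∈ H) :
    (QuotientGroup.mk k : Cosets V) ∈ fixedSet H V U ↔ conj k⁻¹ U ≤ V := by
  constructor
  · rintro ⟨_, h⟩ u hu
    rw [mem_conj, inv_inv] at hu
    have h1 := QuotientGroup.eq.mp (h _ hu).symm
    change k⁻¹ * (k * u * k⁻¹ * k) ∈ V at h1
    simpa [mul_assoc] using h1
  · intro h
    refine ⟨⟨k, hk, rfl⟩, fun u hu => ?_⟩
    refine (QuotientGroup.eq.mpr ?_).symm
    change k⁻¹ * (u * k) ∈ V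
    refine h (mem_conj.mpr ?_)
    simpa [mul_assoc] using hu

theorem FixedCosets.rep_mem {H V U : OpenSubgroup G} (x : FixedCosets H V U) : x.rep ∈ H :=
  (Quotient.out x.1 : H.toSubgroup).2

theorem FixedCosets.mk_rep_mem {H V U : OpenSubgroup G} (hU : U ≤ H) (x : FixedCosets H V U) :
    (QuotientGroup.mk x.rep : Cosets V) ∈ fixedSet H V U :=
  (mk_mem_fixedSet x.rep_mem).mpr (x.conj_rep_le hU)

theorem FixedCosets.bijective_mk_rep {H V U : OpenSubgroup G} (hU : U ≤ H) :
    Function.Bijective (fun x : FixedCosets H V U =>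
      (⟨QuotientGroup.mk x.rep, x.mk_rep_mem hU⟩ : fixedSet H V U)) := by
  constructor
  · intro x y hxy
    have h1 : (QuotientGroup.mk x.rep : Cosets V) = QuotientGroup.mk y.rep :=
      congrArg Subtype.val hxy
    have h2 : (QuotientGroup.mk (Quotient.out x.1) : RelCosets H V)
        = QuotientGroup.mk (Quotient.out y.1) := by
      rw [QuotientGroup.eq] at h1 ⊢
      exact h1
    refine Subtype.ext ?_
    rw [← QuotientGroup.out_eq' x.1, ← QuotientGroup.out_eq' y.1]
    exact h2
  · rintro ⟨z, ⟨k, hk, rfl⟩, hz⟩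
    have hfix : (QuotientGroup.mk (⟨k, hk⟩ : H.toSubgroup) : RelCosets H V) ∈
        MulAction.fixedPoints (U.toSubgroup.subgroupOf H.toSubgroup) (RelCosets H V) := by
      rintro ⟨⟨u, huH⟩, hu⟩
      have h1 := QuotientGroup.eq.mp (hz u hu)
      exact QuotientGroup.eq.mpr h1
    refine ⟨⟨_, hfix⟩, Subtype.ext ?_⟩
    have h2 : (QuotientGroup.mk (Quotient.out (QuotientGroup.mk (⟨k, hk⟩ : H.toSubgroup) :
        RelCosets H V)) : RelCosets H V) = QuotientGroup.mk (⟨k, hk⟩ : H.toSubgroup) :=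
      QuotientGroup.out_eq' _
    have h3 := QuotientGroup.eq.mp h2
    rw [Subgroup.mem_subgroupOf] at h3
    exact QuotientGroup.eq.mpr h3

variable [CompactSpace G]

instance (V : OpenSubgroup G) : Finite (Cosets V) :=
  Subgroup.quotient_finite_of_isOpen V.toSubgroup V.isOpen

instance (V : OpenSubgroup G) : Fintype (Cosets V) := Fintype.ofFinite _

instance (V U : OpenSubgroup G) : Fintype (RelCosets V U) := Fintype.ofFinite _

theorem index_ne_zero (V : OpenSubgroup G) : V.toSubgroup.index ≠ 0 :=
  Subgroup.index_ne_zero_of_finite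

theorem index_lt_of_lt {U V : OpenSubgroup G} (h : U < V) :
    V.toSubgroup.index < U.toSubgroup.index := by
  have : U.toSubgroup.FiniteIndex := ⟨index_ne_zero U⟩
  exact Subgroup.index_strictAnti h

theorem eq_of_le_of_index_le {U V : OpenSubgroup G} (h : U ≤ V)
    (hi : U.toSubgroup.index ≤ V.toSubgroup.index) : U = V := by
  rcases h.eq_or_lt with h | h
  · exact h
  · exact absurd (index_lt_of_lt h) (by omega)

theorem card_relCosets {U V : OpenSubgroup G} (h : U ≤ V) :
    Fintype.card (RelCosets V U) = U.toSubgroup.index / V.toSubgroup.index := by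
  have h1 : Fintype.card (RelCosets V U) = U.toSubgroup.relIndex V.toSubgroup := by
    rw [← Nat.card_eq_fintype_card]
    rfl
  rw [h1, ← Subgroup.relIndex_mul_index (show U.toSubgroup ≤ V.toSubgroup from h),
    Nat.mul_div_cancel _ (Nat.pos_of_ne_zero (index_ne_zero V))]

/-- Only finitely many open subgroups contain a given one. -/
theorem finite_overgroups (U : OpenSubgroup G) : {V : OpenSubgroup G | U ≤ V}.Finite := by
  refine Set.Finite.of_finite_image (f := fun V : OpenSubgroup G =>
    ((QuotientGroup.mk : G → Cosets U) '' (V : Set G))) (Set.toFinite _) ?_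
  have key : ∀ V : OpenSubgroup G, U ≤ V → ∀ x : G,
      (QuotientGroup.mk x : Cosets U) ∈ (QuotientGroup.mk : G → Cosets U) '' (V : Set G) ↔
        x ∈ V := by
    intro V hV x
    constructor
    · rintro ⟨y, hy, hyx⟩
      have := V.mul_mem hy (hV (QuotientGroup.eq.mp hyx))
      simpa using this
    · exact fun hx => ⟨x, hx, rfl⟩
  intro V hV W hW hVW
  ext x
  rw [← key V hV, ← key W hW]
  exact iff_of_eq (congrArg (fun s => (QuotientGroup.mk x : Cosets U) ∈ s) hVW)

/-- The finite set of `U`-fixed cosets in `G / V` that have a representative in `H`. -/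
def fixedFinset (H V U : OpenSubgroup G) : Finset (Cosets V) :=
  (Set.toFinite (fixedSet H V U)).toFinset

theorem mem_fixedFinset {H V U : OpenSubgroup G} {z : Cosets V} :
    z ∈ fixedFinset H V U ↔ z ∈ fixedSet H V U :=
  Set.Finite.mem_toFinset _

variable {P : ModPair.{u}}

/-- The contribution `∑_{hV ∈ (H/V)^U} h · f_{G/V}(n^{⊗ V/h⁻¹Uh})` of a single subgroup `V` to the
component at `U` of the ghost map. -/
def tau {H : OpenSubgroup G} {V : OpenSubgroup G} (σ : Cosets V → G)
    (hσ : ∀ x, (QuotientGroup.mk (σ x) : Cosets V) = x) (n : TPow P (Cosets V))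
    {U : OpenSubgroup G} (hU : U ≤ H) : TPow P (Cosets U) :=
  ∑ᶠ x : FixedCosets H V U,
    TPow.act x.rep (conj_conj_inv x.rep U) (TPow.cosetPow (x.conj_rep_le hU) σ hσ n)

variable {H V U : OpenSubgroup G} {σ : Cosets V → G}
  {hσ : ∀ x, (QuotientGroup.mk (σ x) : Cosets V) = x} (hU : U ≤ H)

theorem tau_eq_zero (h : ¬ (fixedSet H V U).Nonempty) (n : TPow P (Cosets V)) :
    tau σ hσ n hU = 0 := by
  have : IsEmpty (FixedCosets H V U) := ⟨fun x => h ⟨_, x.mk_rep_mem hU⟩⟩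
  exact finsum_of_isEmpty _

theorem isPoly_tau (p q : TPow P (Cosets V)) :
    IsPoly (fun t : ℤ => tau σ hσ (p + t • q) hU) := by
  cases nonempty_fintype (FixedCosets H V U)
  simp only [tau, finsum_eq_sum_of_fintype]
  refine IsPoly.sum _ fun x _ => ?_
  exact (TPow.isPoly_pow p q).comp ((TPow.act (P := P) x.rep (conj_conj_inv x.rep U)).toLinearMap ∘ₗ
    (TPow.reindex (cosetProd (x.conj_rep_le hU) σ hσ)).toLinearMap).toAddMonoidHom

theorem map_tau {Q : ModPair.{u}} (f : P ⟶ Q) (n : TPow P (Cosets V)) :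
    TPow.map _ f (tau σ hσ n hU) = tau σ hσ (TPow.map _ f n) hU := by
  cases nonempty_fintype (FixedCosets H V U)
  simp only [tau, finsum_eq_sum_of_fintype, map_sum]
  refine Finset.sum_congr rfl fun x _ => ?_
  rw [TPow.act, TPow.map_reindex, TPow.cosetPow, TPow.map_reindex, TPow.map_pow]
  rfl

open Classical in
/-- The summands of the ghost map, expanded on a sum of scaled pure tensors. -/
theorem act_cosetPow_sum {ι : Type*} [Fintype ι] (r : ι → P.ring) (m : ι → Cosets V → P.mod)
    (k : G) (hk : conj k⁻¹ U ≤ V) :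
    TPow.act k (conj_conj_inv k U) (TPow.cosetPow hk σ hσ (∑ i, r i • TPow.tprod P (m i))) =
      ∑ F : RelCosets V (conj k⁻¹ U) → ι, (∏ s, r (F s)) • TPow.tprod P (fun y : Cosets U =>
        m (F ((cosetProd hk σ hσ).symm ((cosetConj k (conj_conj_inv k U)).symm y)).2)
          (y.out • (QuotientGroup.mk k : Cosets V))) := by
  rw [TPow.cosetPow, TPow.pow_sum_tprod]
  simp only [map_sum, map_smul, TPow.act, TPow.reindex_tprod]
  refine Finset.sum_congr rfl fun F _ => ?_
  congr 2
  funext y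
  congr 1
  conv_lhs => rw [← QuotientGroup.out_eq' y]
  rfl

theorem act_cosetPow_tprod (r : P.ring) (m : Cosets V → P.mod) (k : G) (hk : conj k⁻¹ U ≤ V) :
    TPow.act k (conj_conj_inv k U) (TPow.cosetPow hk σ hσ (r • TPow.tprod P m)) =
      r ^ (U.toSubgroup.index / V.toSubgroup.index) • TPow.tprod P (fun y : Cosets U =>
        m (y.out • (QuotientGroup.mk k : Cosets V))) := by
  classical
  have := act_cosetPow_sum (U := U) (hσ := hσ) (fun _ : Unit => r) (fun _ => m) k hk
  simp only [Finset.univ_unique, Finset.sum_singleton, Finset.prod_const] at this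
  rw [this, Finset.card_univ, card_relCosets hk, index_conj]

theorem tau_eq_sum (n : TPow P (Cosets V)) (f : Cosets V → TPow P (Cosets U))
    (h : ∀ (k : G) (hk : conj k⁻¹ U ≤ V), k ∈ H →
      TPow.act k (conj_conj_inv k U) (TPow.cosetPow hk σ hσ n) = f (QuotientGroup.mk k)) :
    tau σ hσ n hU = ∑ z ∈ fixedFinset H V U, f z := by
  have h1 : tau σ hσ n hU = ∑ᶠ z : fixedSet H V U, f z.1 :=
    finsum_eq_of_bijective _ (FixedCosets.bijective_mk_rep hU) fun x =>
      h x.rep (x.conj_rep_le hU) x.rep_mem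
  rw [h1, finsum_set_coe_eq_finsum_mem, finsum_mem_eq_finite_toFinset_sum _ (Set.toFinite _),
    fixedFinset]

/-- On a scaled pure tensor, the contribution of `V` to the ghost map does not depend on the
representatives of the cosets. -/
theorem tau_tprod (r : P.ring) (m : Cosets V → P.mod) :
    tau σ hσ (r • TPow.tprod P m) hU = ∑ z ∈ fixedFinset H V U,
      r ^ (U.toSubgroup.index / V.toSubgroup.index) • TPow.tprod P (fun y : Cosets U =>
        m (y.out • z)) :=
  tau_eq_sum hU _ _ fun k hk _ => act_cosetPow_tprod r m k hk

/-- At the level of `V` itself, the contribution of `V` to the ghost map is additive. -/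
theorem tau_self_add (hV : V ≤ H) (a b : TPow P (Cosets V)) :
    tau σ hσ (a + b) hV = tau σ hσ a hV + tau σ hσ b hV := by
  classical
  cases nonempty_fintype (FixedCosets H V V)
  simp only [tau, finsum_eq_sum_of_fintype, ← Finset.sum_add_distrib]
  refine Finset.sum_congr rfl fun x _ => ?_
  have hsub : Subsingleton (RelCosets V (conj x.rep⁻¹ V)) := by
    rw [← Fintype.card_le_one_iff_subsingleton, card_relCosets (x.conj_rep_le hV), index_conj]
    exact (Nat.div_self (Nat.pos_of_ne_zero (index_ne_zero V))).le
  rw [← map_add]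
  congr 1
  rw [TPow.cosetPow, TPow.cosetPow, TPow.cosetPow, ← map_add]
  congr 1
  let o : RelCosets V (conj x.rep⁻¹ V) := QuotientGroup.mk 1
  have key : ∀ c : TPow P (Cosets V), (fun _ : RelCosets V (conj x.rep⁻¹ V) => c)
      = Function.update (fun _ => 0) o c := by
    intro c
    funext y
    rw [Subsingleton.elim y o, Function.update_self]
  rw [TPow.pow, TPow.pow, TPow.pow, key (a + b), key a, key b, MultilinearMap.map_update_add]

end Cosets

/-! ### Fixed points of colourings -/

section Coloring

variable {G : Type u} [Group G] [TopologicalSpace G] [IsTopologicalGroup G]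

/-- A coset `z ∈ G / V` together with a partial colouring of `G`. Only the colourings that are
defined exactly on the coset `{y | y z = V}` of `V` matter, see `Coloring.total`. -/
@[ext]
structure Coloring (V : OpenSubgroup G) (ι : Type) : Type u where
  base : Cosets V
  color : G → Option ι

variable {H V U : OpenSubgroup G} {ι : Type}

instance : MulAction G (Coloring V ι) where
  smul g a := ⟨g • a.base, fun y => a.color (y * g)⟩
  one_smul a := Coloring.ext (one_smul G a.base) (funext fun y => congrArg a.color (mul_one y))
  mul_smul g h a := Coloring.ext (mul_smul g h a.base)
    (funext fun y => congrArg a.color (mul_assoc y g h).symm)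

theorem Coloring.smul_base (g : G) (a : Coloring V ι) : (g • a).base = g • a.base := rfl

theorem Coloring.smul_color (g : G) (a : Coloring V ι) (y : G) :
    (g • a).color y = a.color (y * g) := rfl

/-- The pairs `(kV, E)` with `k ∈ H` and `E` a colouring of `V k⁻¹`. -/
def Coloring.total (H V : OpenSubgroup G) (ι : Type) : Set (Coloring V ι) :=
  {a | (∃ k ∈ H, (QuotientGroup.mk k : Cosets V) = a.base) ∧
    ∀ y, a.color y = none ↔ y • a.base ≠ QuotientGroup.mk 1}

theorem Coloring.smul_mem_total {h : G} (hh : h ∈ H) {a : Coloring V ι}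
    (ha : a ∈ Coloring.total H V ι) : h • a ∈ Coloring.total H V ι := by
  obtain ⟨⟨k, hk, hka⟩, ha⟩ := ha
  refine ⟨⟨h * k, H.mul_mem hh hk, ?_⟩, fun y => ?_⟩
  · rw [Coloring.smul_base, ← hka]
    rfl
  · rw [Coloring.smul_color, ha, Coloring.smul_base, mul_smul]

/-- The elements of a subset of a `G`-set fixed by an open subgroup `U`. -/
def fixedIn {A : Type*} [MulAction G A] (A₀ : Set A) (U : OpenSubgroup G) : Set A :=
  {a | a ∈ A₀ ∧ ∀ u ∈ U, u • a = a}

variable {P : ModPair.{u}}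

/-- The scalar `∏ r_{E(s)}`, over the cosets `s ∈ G / U` on which the colouring `E` is defined. -/
def Coloring.scalar [CompactSpace G] (r : ι → P.ring) (a : Coloring V ι) (U : OpenSubgroup G) :
    P.ring :=
  ∏ y : Cosets U, (a.color y.out).elim 1 r

/-- The vector at `gU` in the pure tensor attached to a colouring. The value `0` for an undefined
colour never occurs for the colourings in `Coloring.total`. -/
def Coloring.vector (σ : Cosets V → G) (m : ι → Cosets V → P.mod) (a : Coloring V ι) (g : G) :
    P.mod :=
  (a.color ((σ (g • a.base))⁻¹ * g)).elim 0 fun i => m i (g • a.base)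

theorem Coloring.vector_smul (σ : Cosets V → G) (m : ι → Cosets V → P.mod) (a : Coloring V ι)
    (h g : G) : (h • a).vector σ m g = a.vector σ m (g * h) := by
  simp only [Coloring.vector, Coloring.smul_base, Coloring.smul_color, smul_smul, mul_assoc]

theorem Coloring.exists_vector_eq {σ : Cosets V → G}
    (hσ : ∀ x, (QuotientGroup.mk (σ x) : Cosets V) = x) (m : ι → Cosets V → P.mod)
    {a : Coloring V ι} (ha : a ∈ Coloring.total H V ι) (g : G) :
    ∃ i x, a.vector σ m g = m i x := by
  have h1 : ((σ (g • a.base))⁻¹ * g) • a.base = QuotientGroup.mk 1 := by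
    rw [mul_smul, inv_smul_eq_iff]
    exact (hσ _).symm.trans (congrArg QuotientGroup.mk (mul_one _).symm)
  have h2 : a.color ((σ (g • a.base))⁻¹ * g) ≠ none := fun h => (ha.2 _).mp h h1
  obtain ⟨i, hi⟩ := Option.ne_none_iff_exists'.mp h2
  exact ⟨i, _, by rw [Coloring.vector, hi]; rfl⟩

section Scalar

variable [CompactSpace G] {r : ι → P.ring}

theorem Coloring.color_out (a : Coloring V ι) (hfix : ∀ u ∈ U, u • a = a) (g : G) :
    a.color (QuotientGroup.mk g : Cosets U).out = a.color g := by
  have h2 := QuotientGroup.eq.mp (QuotientGroup.out_eq' (QuotientGroup.mk g : Cosets U))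
  have h3 := congrArg (fun b => b.color (QuotientGroup.mk g : Cosets U).out) (hfix _ h2)
  simp only [Coloring.smul_color, mul_inv_cancel_left] at h3
  exact h3.symm

theorem Coloring.scalar_smul (a : Coloring V ι) (h : G) (U : OpenSubgroup G)
    (hfix : ∀ u ∈ U, u • a = a) :
    (h • a).scalar r (conj h U) = a.scalar r U := by
  refine (Fintype.prod_equiv (cosetConj h rfl) _ _ fun y => ?_).symm
  have h1 : (QuotientGroup.mk ((cosetConj h (rfl : conj h U = _) y).out * h) : Cosets U) = y := by
    have := congrArg (cosetConj h rfl).symm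
      (QuotientGroup.out_eq' (cosetConj h (rfl : conj h U = _) y))
    rw [Equiv.symm_apply_apply] at this
    exact this
  rw [Coloring.smul_color, ← Coloring.color_out a hfix (_ * h), h1]

theorem Coloring.scalar_eq_pow (a : Coloring V ι) {U U' : OpenSubgroup G} (h : U ≤ U')
    (hfix : ∀ u ∈ U', u • a = a) :
    a.scalar r U = a.scalar r U' ^ (U.toSubgroup.index / U'.toSubgroup.index) := by
  classical
  let e : Cosets U ≃ Cosets U' × RelCosets U' U :=
    (cosetProd h Quotient.out (fun x => QuotientGroup.out_eq' x)).symm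
  rw [Coloring.scalar, Coloring.scalar, ← card_relCosets h, ← Finset.prod_pow]
  rw [Fintype.prod_equiv e _ (fun p => (a.color p.1.out).elim 1 r) (fun y => ?_),
    Fintype.prod_prod_type]
  · simp
  · rw [show (e y).1 = QuotientGroup.mk y.out by
      conv_lhs => rw [← QuotientGroup.out_eq' y]
      rfl, Coloring.color_out a hfix]

theorem Coloring.scalar_mem (a : Coloring V ι) (M : Submonoid P.ring) (hr : ∀ i, r i ∈ M) :
    a.scalar r U ∈ M := by
  refine Submonoid.prod_mem _ fun y _ => ?_
  cases a.color y.out with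
  | none => exact M.one_mem
  | some i => exact hr i

end Scalar

/-- The colouring of `V k⁻¹` that a colouring of the quotient `V / k⁻¹Uk` induces. -/
def Coloring.ofRel (k : G) (F : RelCosets V (conj k⁻¹ U) → ι) : Coloring V ι :=
  open Classical in
  ⟨QuotientGroup.mk k, fun y =>
    if h : y * k ∈ V then some (F (QuotientGroup.mk ⟨y * k, h⟩)) else none⟩

theorem Coloring.ofRel_color_pos {k : G} (F : RelCosets V (conj k⁻¹ U) → ι) {y : G}
    (h : y * k ∈ V) :
    (Coloring.ofRel k F).color y = some (F (QuotientGroup.mk ⟨y * k, h⟩)) :=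
  dif_pos h

theorem Coloring.ofRel_color_neg {k : G} (F : RelCosets V (conj k⁻¹ U) → ι) {y : G}
    (h : y * k ∉ V) : (Coloring.ofRel k F).color y = none :=
  dif_neg h

theorem Coloring.ofRel_mem {k : G} (hk : k ∈ H) (hUV : conj k⁻¹ U ≤ V)
    (F : RelCosets V (conj k⁻¹ U) → ι) :
    Coloring.ofRel k F ∈ fixedIn (Coloring.total H V ι) U := by
  refine ⟨⟨⟨k, hk, rfl⟩, fun y => ?_⟩, fun u hu => ?_⟩
  · change _ ↔ y • (QuotientGroup.mk k : Cosets V) ≠ _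
    rw [Ne, smul_mk_eq_mk_one]
    by_cases h : y * k ∈ V
    · simp [Coloring.ofRel_color_pos F h, h]
    · simp [Coloring.ofRel_color_neg F h, h]
  · have hz := ((mk_mem_fixedSet hk).mpr hUV).2 u hu
    refine Coloring.ext hz (funext fun y => ?_)
    rw [Coloring.smul_color]
    have hu' : k⁻¹ * u * k ∈ conj k⁻¹ U := by
      rw [mem_conj]
      simpa [mul_assoc] using hu
    have e : y * u * k = y * k * (k⁻¹ * u * k) := by group
    have hiff : y * u * k ∈ V ↔ y * k ∈ V := by
      rw [e]
      exact V.toSubgroup.mul_mem_cancel_right (hUV hu')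
    by_cases h : y * k ∈ V
    · rw [Coloring.ofRel_color_pos F h, Coloring.ofRel_color_pos F (hiff.mpr h)]
      congr 2
      refine (QuotientGroup.eq.mpr ?_).symm
      rw [Subgroup.mem_subgroupOf]
      change (y * k)⁻¹ * (y * u * k) ∈ conj k⁻¹ U
      rwa [e, inv_mul_cancel_left]
    · rw [Coloring.ofRel_color_neg F h, Coloring.ofRel_color_neg F (hiff.not.mpr h)]

theorem Coloring.ofRel_bijective (hU : U ≤ H) :
    Function.Bijective (fun p : Σ x : FixedCosets H V U, (RelCosets V (conj x.rep⁻¹ U) → ι) =>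
      (⟨Coloring.ofRel p.1.rep p.2, Coloring.ofRel_mem p.1.rep_mem (p.1.conj_rep_le hU) p.2⟩ :
        fixedIn (Coloring.total H V ι) U)) := by
  constructor
  · rintro ⟨x, F⟩ ⟨x', F'⟩ h
    have h1 : Coloring.ofRel x.rep F = Coloring.ofRel x'.rep F' := congrArg Subtype.val h
    obtain rfl : x = x' := (FixedCosets.bijective_mk_rep hU).1
      (Subtype.ext (congrArg Coloring.base h1))
    congr 1
    funext s
    obtain ⟨⟨v, hv⟩, rfl⟩ := QuotientGroup.mk_surjective s
    have hv' : v * x.rep⁻¹ * x.rep ∈ V := by simpa using hv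
    have h2 := congrArg (fun a => a.color (v * x.rep⁻¹)) h1
    simp only [Coloring.ofRel_color_pos _ hv', Option.some.injEq] at h2
    simpa using h2
  · rintro ⟨a, ⟨⟨k₀, hk₀, hka⟩, htot⟩, hfix⟩
    have hz : a.base ∈ fixedSet H V U :=
      ⟨⟨k₀, hk₀, hka⟩, fun u hu => congrArg Coloring.base (hfix u hu)⟩
    obtain ⟨x, hx⟩ := (FixedCosets.bijective_mk_rep hU).2 ⟨a.base, hz⟩
    have hx : (QuotientGroup.mk x.rep : Cosets V) = a.base := congrArg Subtype.val hx
    have hsome : ∀ y, y * x.rep ∈ V → a.color y ≠ none := by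
      intro y hy hn
      refine (htot y).mp hn ?_
      rw [← hx, smul_mk_eq_mk_one]
      exact hy
    have hs : ∀ s : RelCosets V (conj x.rep⁻¹ U), ∃ i, a.color (s.out.1 * x.rep⁻¹) = some i :=
      fun s => Option.ne_none_iff_exists'.mp (hsome _ (by simp))
    choose F hF using hs
    refine ⟨⟨x, F⟩, Subtype.ext (Coloring.ext hx (funext fun y => ?_))⟩
    change (Coloring.ofRel x.rep F).color y = a.color y
    by_cases h : y * x.rep ∈ V
    · rw [Coloring.ofRel_color_pos F h, ← hF]
      have h1 := QuotientGroup.eq.mp (QuotientGroup.out_eq'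
        (QuotientGroup.mk ⟨y * x.rep, h⟩ : RelCosets V (conj x.rep⁻¹ U)))
      rw [Subgroup.mem_subgroupOf] at h1
      change _ ∈ conj x.rep⁻¹ U at h1
      rw [mem_conj] at h1
      have h2 := congrArg (fun b => b.color ((QuotientGroup.mk ⟨y * x.rep, h⟩ :
        RelCosets V (conj x.rep⁻¹ U)).out.1 * x.rep⁻¹)) (hfix _ h1)
      simp only [Coloring.smul_color] at h2
      rw [← h2]
      congr 1
      simp only [Subgroup.coe_mul, InvMemClass.coe_inv]
      group
    · rw [Coloring.ofRel_color_neg F h, eq_comm, htot, ← hx, Ne, smul_mk_eq_mk_one]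
      exact h

variable [CompactSpace G]

theorem Coloring.finite_fixedIn [Finite ι] (hU : U ≤ H) :
    (fixedIn (Coloring.total H V ι) U).Finite :=
  Set.finite_coe_iff.mp (Finite.of_surjective _ (Coloring.ofRel_bijective hU).2)

theorem Coloring.scalar_ofRel (k : G) (F : RelCosets V (conj k⁻¹ U) → ι) (r : ι → P.ring)
    (hk : k ∈ H) (hUV : conj k⁻¹ U ≤ V) :
    (Coloring.ofRel k F).scalar r U = ∏ s, r (F s) := by
  have hfix := (Coloring.ofRel_mem hk hUV F).2
  refine (Fintype.prod_of_injective (fun s : RelCosets V (conj k⁻¹ U) =>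
    (QuotientGroup.mk (s.out.1 * k⁻¹) : Cosets U)) ?_ _ _ ?_ ?_).symm
  · intro s t hst
    have h1 := QuotientGroup.eq.mp hst
    rw [← QuotientGroup.out_eq' s, ← QuotientGroup.out_eq' t, QuotientGroup.eq,
      Subgroup.mem_subgroupOf]
    change _ ∈ conj k⁻¹ U
    rw [mem_conj]
    convert! h1 using 1
    simp only [Subgroup.coe_mul, InvMemClass.coe_inv]
    group
  · intro y hy
    rw [Coloring.ofRel_color_neg]
    · rfl
    · intro hV
      refine hy ⟨QuotientGroup.mk ⟨y.out * k, hV⟩, ?_⟩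
      have h1 := QuotientGroup.eq.mp (QuotientGroup.out_eq'
        (QuotientGroup.mk ⟨y.out * k, hV⟩ : RelCosets V (conj k⁻¹ U)))
      rw [Subgroup.mem_subgroupOf] at h1
      change _ ∈ conj k⁻¹ U at h1
      rw [mem_conj] at h1
      conv_rhs => rw [← QuotientGroup.out_eq' y]
      refine QuotientGroup.eq.mpr ?_
      convert! h1 using 1
      simp only [Subgroup.coe_mul, InvMemClass.coe_inv]
      group
  · intro s
    have h : s.out.1 * k⁻¹ * k ∈ V := by simp
    rw [Coloring.color_out _ hfix, Coloring.ofRel_color_pos F h]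
    conv_lhs => rw [← QuotientGroup.out_eq' s]
    simp

/-- The contribution of `V` to the ghost map, on a sum of scaled pure tensors, as a sum over the
`U`-fixed colourings. -/
theorem tau_sum [Fintype ι] {σ : Cosets V → G}
    {hσ : ∀ x, (QuotientGroup.mk (σ x) : Cosets V) = x} (hU : U ≤ H)
    (r : ι → P.ring) (m : ι → Cosets V → P.mod) :
    tau σ hσ (∑ i, r i • TPow.tprod P (m i)) hU =
      ∑ᶠ a : fixedIn (Coloring.total H V ι) U,
        a.1.scalar r U • TPow.tprod P (fun y : Cosets U => a.1.vector σ m y.out) := by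
  classical
  cases nonempty_fintype (FixedCosets H V U)
  have h0 := finsum_eq_of_bijective (f := fun p : Σ x : FixedCosets H V U,
    (RelCosets V (conj x.rep⁻¹ U) → ι) => (∏ s, r (p.2 s)) • TPow.tprod P (fun y : Cosets U =>
      m (p.2 ((cosetProd (p.1.conj_rep_le hU) σ hσ).symm
        ((cosetConj p.1.rep (conj_conj_inv p.1.rep U)).symm y)).2)
          (y.out • (QuotientGroup.mk p.1.rep : Cosets V))))
    (g := fun a : fixedIn (Coloring.total H V ι) U =>
        a.1.scalar r U • TPow.tprod P (fun y : Cosets U => a.1.vector σ m y.out))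
    _ (Coloring.ofRel_bijective hU) (fun p => ?_)
  · rw [← h0, tau, finsum_eq_sum_of_fintype, finsum_eq_sum_of_fintype, Fintype.sum_sigma]
    exact Finset.sum_congr rfl fun x _ => act_cosetPow_sum r m x.rep (x.conj_rep_le hU)
  · rw [Coloring.scalar_ofRel p.1.rep p.2 r p.1.rep_mem (p.1.conj_rep_le hU)]
    congr 2
    funext y
    have h1 : (σ (y.out • (QuotientGroup.mk p.1.rep : Cosets V)))⁻¹ * y.out * p.1.rep ∈ V := by
      have := QuotientGroup.eq.mp (hσ (y.out • (QuotientGroup.mk p.1.rep : Cosets V)))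
      rw [mul_assoc]
      exact this
    rw [Coloring.vector]
    change _ = ((Coloring.ofRel p.1.rep p.2).color
      ((σ (y.out • (QuotientGroup.mk p.1.rep : Cosets V)))⁻¹ * y.out)).elim 0 _
    rw [Coloring.ofRel_color_pos p.2 h1]
    change _ = m _ _
    congr 2
    conv_lhs => rw [← QuotientGroup.out_eq' y]
    have h2 : ∀ (z : G) (hz : (σ (QuotientGroup.mk (z * p.1.rep)))⁻¹ * (z * p.1.rep) ∈ V)
      (hz' : (σ (QuotientGroup.mk (z * p.1.rep)))⁻¹ * z * p.1.rep ∈ V),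
      (QuotientGroup.mk ⟨_, hz⟩ : RelCosets V (conj p.1.rep⁻¹ U)) = QuotientGroup.mk ⟨_, hz'⟩ := by
      intro z hz hz'
      congr 2
      rw [mul_assoc]
    exact congrArg p.2 (h2 _ _ _)

end Coloring

/-! ### Tensor powers of free modules -/

section Free

variable {X Y Z W : Type u}

/-- The monomials in the ring of `freeModPair X Y`. -/
def monomials (X Y : Type u) : Submonoid (freeModPair X Y).ring :=
  Submonoid.closure (Set.range (freeX Y))

/-- The pure tensor of generators `⨂ y_{m z}`. -/
def pureY (X : Type u) (m : Z → Y) : TPow (freeModPair X Y) Z :=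
  TPow.tprod (freeModPair X Y) fun z => freeY X (m z)

/-- The pure tensors of generators form a basis of a tensor power of a free module. -/
def tpowBasis (X Y Z : Type u) [Finite Z] :
    Module.Basis (Z → Y) (freeModPair X Y).ring (TPow (freeModPair X Y) Z) :=
  Basis.piTensorProduct (R := MvPolynomial X ℤ) (M := fun _ : Z => Y →₀ MvPolynomial X ℤ)
    fun _ => Finsupp.basisSingleOne

theorem tpowBasis_apply [Finite Z] (m : Z → Y) : tpowBasis X Y Z m = pureY X m := by
  refine (Basis.piTensorProduct_apply (R := MvPolynomial X ℤ)
    (M := fun _ : Z => Y →₀ MvPolynomial X ℤ) (fun _ => Finsupp.basisSingleOne) m).trans ?_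
  simp only [Finsupp.coe_basisSingleOne]
  rfl

/-- The tensor power of a free object is additively generated by the multiples of pure tensors of
generators by monomials. -/
theorem closure_monomial_pureY [Finite Z] : AddSubgroup.closure
    {z : TPow (freeModPair X Y) Z | ∃ r ∈ monomials X Y, ∃ m : Z → Y, r • pureY X m = z} = ⊤ := by
  rw [eq_top_iff]
  rintro z -
  rw [← (tpowBasis X Y Z).linearCombination_repr z, Finsupp.linearCombination_apply]
  refine AddSubgroup.sum_mem _ fun m _ => ?_
  let f : MvPolynomial X ℤ →+ TPow (freeModPair X Y) Z :=
    (smulAddHom (freeModPair X Y).ring (TPow (freeModPair X Y) Z)).flip (tpowBasis X Y Z m)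
  suffices hf : ∀ c, f c ∈ AddSubgroup.closure
      {z : TPow (freeModPair X Y) Z | ∃ r ∈ monomials X Y, ∃ m : Z → Y, r • pureY X m = z} from
    hf ((tpowBasis X Y Z).repr z m)
  intro c
  induction c using MvPolynomial.induction_on' with
  | monomial s a =>
    have hs : (MvPolynomial.monomial s 1 : MvPolynomial X ℤ) ∈ monomials X Y := by
      rw [MvPolynomial.monomial_eq, map_one, one_mul]
      exact Submonoid.prod_mem (monomials X Y) fun x _ =>
        pow_mem (Submonoid.subset_closure (Set.mem_range_self x)) _
    have h1 : (MvPolynomial.monomial s a : MvPolynomial X ℤ)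
        = a • (MvPolynomial.monomial s 1 : MvPolynomial X ℤ) := by
      rw [MvPolynomial.smul_monomial, smul_eq_mul, mul_one]
    rw [h1, map_zsmul]
    have h2 : f (MvPolynomial.monomial s 1) ∈
        {z : TPow (freeModPair X Y) Z | ∃ r ∈ monomials X Y, ∃ m : Z → Y, r • pureY X m = z} :=
      ⟨_, hs, m, by rw [← tpowBasis_apply]; rfl⟩
    exact AddSubgroup.zsmul_mem _ (AddSubgroup.subset_closure h2) a
  | add p q hp hq =>
    rw [map_add]
    exact AddSubgroup.add_mem _ hp hq

theorem tpow_addHom_ext [Finite Z] {A : Type*} [AddCommGroup A]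
    {f g : TPow (freeModPair X Y) Z →+ A}
    (h : ∀ r ∈ monomials X Y, ∀ m : Z → Y, f (r • pureY X m) = g (r • pureY X m)) : f = g := by
  refine AddMonoidHom.eq_of_eqOn_dense closure_monomial_pureY ?_
  rintro _ ⟨r, hr, m, rfl⟩
  exact h r hr m

/-- A sum of multiples of pure tensors of generators by monomials; these are the tensors all of
whose coefficients are nonnegative. -/
def IsPos (z : TPow (freeModPair X Y) Z) : Prop :=
  ∃ (ι : Type) (_ : Fintype ι) (r : ι → (freeModPair X Y).ring) (m : ι → Z → Y),
    (∀ i, r i ∈ monomials X Y) ∧ z = ∑ i, r i • pureY X (m i)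

theorem IsPos.zero : IsPos (0 : TPow (freeModPair X Y) Z) :=
  ⟨Empty, inferInstance, fun e => e.elim, fun e => e.elim, fun e => e.elim, by simp⟩

theorem IsPos.add {a b : TPow (freeModPair X Y) Z} (ha : IsPos a) (hb : IsPos b) :
    IsPos (a + b) := by
  obtain ⟨ι, _, r, m, hr, rfl⟩ := ha
  obtain ⟨κ, _, r', m', hr', rfl⟩ := hb
  exact ⟨ι ⊕ κ, inferInstance, Sum.elim r r', Sum.elim m m', by
    rintro (i | i)
    exacts [hr i, hr' i], by simp⟩

theorem IsPos.nsmul {a : TPow (freeModPair X Y) Z} (ha : IsPos a) (k : ℕ) : IsPos (k • a) := by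
  induction k with
  | zero => rw [zero_smul]; exact .zero
  | succ k ih => rw [succ_nsmul]; exact ih.add ha

theorem exists_isPos_sub [Finite Z] (z : TPow (freeModPair X Y) Z) :
    ∃ p q, IsPos p ∧ IsPos q ∧ z = p - q := by
  have hz : z ∈ AddSubgroup.closure {z : TPow (freeModPair X Y) Z |
      ∃ r ∈ monomials X Y, ∃ m : Z → Y, r • pureY X m = z} := by
    rw [closure_monomial_pureY]
    trivial
  induction hz using AddSubgroup.closure_induction with
  | mem z hz =>
    obtain ⟨r, hr, m, rfl⟩ := hz
    exact ⟨_, 0, ⟨Unit, inferInstance, fun _ => r, fun _ => m, fun _ => hr, by simp⟩, .zero,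
      (sub_zero _).symm⟩
  | zero => exact ⟨0, 0, .zero, .zero, (sub_zero _).symm⟩
  | add a b _ _ ha hb =>
    obtain ⟨p, q, hp, hq, rfl⟩ := ha
    obtain ⟨p', q', hp', hq', rfl⟩ := hb
    exact ⟨p + p', q + q', hp.add hp', hq.add hq', by abel⟩
  | neg a _ ha =>
    obtain ⟨p, q, hp, hq, rfl⟩ := ha
    exact ⟨q, p, hq, hp, by abel⟩

theorem tpow_nsmul_eq_zero [Finite Z] {z : TPow (freeModPair X Y) Z} {k : ℕ} (hk : k ≠ 0)
    (h : k • z = 0) : z = 0 := by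
  refine (tpowBasis X Y Z).ext_elem fun m => ?_
  have h1 : k • (tpowBasis X Y Z).repr z m = 0 := by
    rw [← Finsupp.smul_apply, ← map_nsmul, h]
    simp
  rw [map_zero]
  have h2 : ∀ c : MvPolynomial X ℤ, k • c = 0 → c = 0 := fun c hc =>
    (smul_eq_zero.mp hc).resolve_left hk
  exact h2 _ h1

/-- The endomorphism `x ↦ x^N`, `y ↦ y` of a free object, a simultaneous lift of Frobenii. -/
def frob (X Y : Type u) (N : ℕ) : freeModPair X Y ⟶ freeModPair X Y :=
  freeLift (fun x => freeX Y x ^ N) (freeY X)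

theorem frob_monomial {r : (freeModPair X Y).ring} (hr : r ∈ monomials X Y) (N : ℕ) :
    (frob X Y N).ringHom r = r ^ N := by
  induction hr using Submonoid.closure_induction with
  | mem r hr =>
    obtain ⟨x, rfl⟩ := hr
    exact freeLift_X _ _ _
  | one => rw [map_one, one_pow]
  | mul a b _ _ ha hb => rw [map_mul, ha, hb, mul_pow]

/-- The additive map `M^{⊗ Z} → M^{⊗ W}` with `r • ⨂ y_{m z} ↦ r^N • ⨂ y_{m (φ w)}` for
monomials `r`. -/
def psi [Finite Z] (X Y : Type u) (N : ℕ) (φ : W → Z) :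
    TPow (freeModPair X Y) Z →+ TPow (freeModPair X Y) W :=
  ((tpowBasis X Y Z).constr ℕ fun m => pureY X fun w => m (φ w)).toAddMonoidHom.comp
    (TPow.map Z (frob X Y N)).toAddMonoidHom

theorem psi_monomial [Finite Z] {r : (freeModPair X Y).ring} (hr : r ∈ monomials X Y) (N : ℕ)
    (φ : W → Z) (m : Z → Y) :
    psi X Y N φ (r • pureY X m) = r ^ N • pureY X fun w => m (φ w) := by
  change (tpowBasis X Y Z).constr ℕ _ (TPow.map Z (frob X Y N) _) = _
  have : TPow.map Z (frob X Y N) (r • pureY X m) = r ^ N • tpowBasis X Y Z m := by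
    rw [LinearMap.map_smulₛₗ, frob_monomial hr, tpowBasis_apply, pureY, TPow.map_tprod]
    congr 2
    funext z
    exact freeLift_Y _ _ _
  rw [this, map_smul, Module.Basis.constr_basis]

end Free

/-! ### The additive ghost components of a free module -/

section Theta

variable {G : Type u} [Group G] [TopologicalSpace G] [IsTopologicalGroup G]

theorem mk_out_smul {H V U : OpenSubgroup G} {z : Cosets V} (hz : z ∈ fixedSet H V U) (g : G) :
    (QuotientGroup.mk g : Cosets U).out • z = g • z := by
  have h := QuotientGroup.eq.mp (QuotientGroup.out_eq' (QuotientGroup.mk g : Cosets U))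
  have h1 := hz.2 _ h
  rw [mul_smul, inv_smul_eq_iff] at h1
  exact h1.symm

theorem cosetConj_symm_smul {g : G} {V V' : OpenSubgroup G} (h : conj g V = V') (a : G)
    (z : Cosets V') : (cosetConj g h).symm (a • z) = a • (cosetConj g h).symm z := by
  obtain ⟨b, rfl⟩ := QuotientGroup.mk_surjective z
  exact congrArg (QuotientGroup.mk : G → Cosets V) (mul_assoc a b g)

theorem cosetConj_symm_mk {g : G} {V V' : OpenSubgroup G} (h : conj g V = V') (a : G) :
    (cosetConj g h).symm (QuotientGroup.mk a) = QuotientGroup.mk (a * g) := rfl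

theorem cosetConj_symm_mem_fixedSet {g : G} {H V V' U : OpenSubgroup G} (hg : g ∈ H)
    (h : conj g V = V') (z : Cosets V') :
    (cosetConj g h).symm z ∈ fixedSet H V U ↔ z ∈ fixedSet H V' U := by
  obtain ⟨b, rfl⟩ := QuotientGroup.mk_surjective z
  refine and_congr ?_ (forall₂_congr fun u hu => ?_)
  · constructor
    · rintro ⟨k, hk, hkz⟩
      exact ⟨k * g⁻¹, H.mul_mem hk (H.inv_mem hg), by
        rw [← Equiv.apply_eq_iff_eq (cosetConj g h).symm, ← hkz, cosetConj_symm_mk,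
          inv_mul_cancel_right]⟩
    · rintro ⟨k, hk, hkz⟩
      exact ⟨k * g, H.mul_mem hk hg, by rw [← hkz, cosetConj_symm_mk]⟩
  · rw [← cosetConj_symm_smul, Equiv.apply_eq_iff_eq]

theorem smul_mem_fixedSet {g : G} {H V U U' : OpenSubgroup G} (hg : g ∈ H)
    (h : conj g U = U') (z : Cosets V) (hz : z ∈ fixedSet H V U) : g • z ∈ fixedSet H V U' := by
  subst h
  obtain ⟨⟨k, hk, rfl⟩, hz⟩ := hz
  refine ⟨⟨g * k, H.mul_mem hg hk, rfl⟩, fun u hu => ?_⟩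
  have := hz _ (mem_conj.mp hu)
  rw [mul_smul, mul_smul, inv_smul_eq_iff] at this
  exact this

variable [CompactSpace G] {X Y : Type u} {H : OpenSubgroup G}

theorem act_monomial {g : G} {V V' : OpenSubgroup G} (h : conj g V = V')
    (r : (freeModPair X Y).ring) (m : Cosets V → Y) :
    TPow.act g h (r • pureY X m) = r • pureY X fun z => m ((cosetConj g h).symm z) := by
  rw [map_smul, TPow.act, pureY, TPow.reindex_tprod]
  rfl

/-- The additive map `M^{⊗ G/V} → M^{⊗ G/U}` that agrees on the multiples of pure tensors of
generators by monomials with the contribution of `V` to the ghost map. The division is exact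
whenever the sum is nonempty, since `U` is then subconjugate to `V`. -/
def theta (X Y : Type u) (H V U : OpenSubgroup G) :
    TPow (freeModPair X Y) (Cosets V) →+ TPow (freeModPair X Y) (Cosets U) :=
  ∑ z ∈ fixedFinset H V U, psi X Y (U.toSubgroup.index / V.toSubgroup.index) fun y => y.out • z

variable {V U : OpenSubgroup G}

theorem theta_monomial {r : (freeModPair X Y).ring} (hr : r ∈ monomials X Y)
    (m : Cosets V → Y) :
    theta X Y H V U (r • pureY X m) = ∑ z ∈ fixedFinset H V U,
      r ^ (U.toSubgroup.index / V.toSubgroup.index) • pureY X fun y => m (y.out • z) := by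
  rw [theta, AddMonoidHom.finsetSum_apply]
  exact Finset.sum_congr rfl fun z _ => psi_monomial hr _ _ _

theorem tau_monomial {σ : Cosets V → G} {hσ : ∀ x, (QuotientGroup.mk (σ x) : Cosets V) = x}
    (hU : U ≤ H) {r : (freeModPair X Y).ring} (hr : r ∈ monomials X Y) (m : Cosets V → Y) :
    tau σ hσ (r • pureY X m) hU = theta X Y H V U (r • pureY X m) := by
  rw [theta_monomial hr]
  exact tau_tprod hU r fun z => freeY X (m z)

theorem theta_eq_zero (h : ¬ (fixedSet H V U).Nonempty) : theta X Y H V U = 0 := by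
  rw [theta, Finset.sum_eq_zero]
  intro z hz
  exact absurd ⟨z, mem_fixedFinset.mp hz⟩ h

theorem tau_self {σ : Cosets V → G} {hσ : ∀ x, (QuotientGroup.mk (σ x) : Cosets V) = x}
    (hV : V ≤ H) (n : TPow (freeModPair X Y) (Cosets V)) :
    tau σ hσ n hV = theta X Y H V V n := by
  let f : TPow (freeModPair X Y) (Cosets V) →+ TPow (freeModPair X Y) (Cosets V) :=
    AddMonoidHom.mk' (fun n => tau σ hσ n hV) (tau_self_add hV)
  have : f = theta X Y H V V := tpow_addHom_ext fun r hr m => tau_monomial hV hr m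
  exact DFunLike.congr_fun this n

theorem theta_act {g : G} (hg : g ∈ H) {V' : OpenSubgroup G} (h : conj g V = V')
    (n : TPow (freeModPair X Y) (Cosets V)) :
    theta X Y H V' U (TPow.act g h n) = theta X Y H V U n := by
  have : (theta X Y H V' U).comp (TPow.act (P := freeModPair X Y) g h).toLinearMap.toAddMonoidHom
      = theta X Y H V U := by
    refine tpow_addHom_ext fun r hr m => ?_
    change theta X Y H V' U (TPow.act g h (r • pureY X m)) = _
    rw [act_monomial, theta_monomial hr, theta_monomial hr]
    refine Finset.sum_equiv (cosetConj g h).symm (fun z => ?_) fun z _ => ?_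
    · rw [mem_fixedFinset, mem_fixedFinset, cosetConj_symm_mem_fixedSet hg]
    · subst h
      simp only [cosetConj_symm_smul, index_conj]
  exact DFunLike.congr_fun this n

theorem act_theta {g : G} (hg : g ∈ H) {U' : OpenSubgroup G} (h : conj g U = U')
    (n : TPow (freeModPair X Y) (Cosets V)) :
    TPow.act g h (theta X Y H V U n) = theta X Y H V U' n := by
  have : (TPow.act (P := freeModPair X Y) g h).toLinearMap.toAddMonoidHom.comp (theta X Y H V U)
      = theta X Y H V U' := by
    refine tpow_addHom_ext fun r hr m => ?_
    change TPow.act g h (theta X Y H V U (r • pureY X m)) = _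
    rw [theta_monomial hr, theta_monomial hr, map_sum]
    refine Finset.sum_equiv (MulAction.toPerm g) (fun z => ?_) fun z hz => ?_
    · rw [mem_fixedFinset, mem_fixedFinset]
      refine ⟨smul_mem_fixedSet hg h z, fun hz => ?_⟩
      have := smul_mem_fixedSet (H.inv_mem hg) (U' := U)
        (by rw [← h, conj_conj, inv_mul_cancel, conj_one]) _ hz
      rwa [MulAction.toPerm_apply, inv_smul_smul] at this
    · rw [act_monomial]
      have hidx : U'.toSubgroup.index = U.toSubgroup.index := by rw [← h, index_conj]
      rw [hidx]
      congr 2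
      funext y
      congr 1
      conv_lhs => rw [← QuotientGroup.out_eq' y]
      rw [cosetConj_symm_mk, mk_out_smul (mem_fixedFinset.mp hz), mul_smul]
      rfl
  exact DFunLike.congr_fun this n

/-- At the level of `V` itself, the summands of `theta` are the actions of the elements of the
normaliser of `V` in `H`. -/
theorem exists_act_eq_psi {z : Cosets V} (hz : z ∈ fixedSet H V V) :
    ∃ (g : G) (_ : g ∈ H) (h : conj g V = V), ∀ n : TPow (freeModPair X Y) (Cosets V),
      psi X Y (V.toSubgroup.index / V.toSubgroup.index) (fun y : Cosets V => y.out • z) n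
        = TPow.act g h n := by
  obtain ⟨k, hk, rfl⟩ := hz.1
  have hle := (mk_mem_fixedSet hk).mp hz
  have h1 : conj k⁻¹ V = V := eq_of_le_of_index_le hle (by rw [index_conj])
  have h : conj k V = V := by
    conv_lhs => rw [← h1]
    rw [conj_conj, mul_inv_cancel, conj_one]
  refine ⟨k, hk, h, fun n => ?_⟩
  have : psi X Y (V.toSubgroup.index / V.toSubgroup.index)
      (fun y : Cosets V => y.out • (QuotientGroup.mk k : Cosets V)) =
      (TPow.act (P := freeModPair X Y) k h).toLinearMap.toAddMonoidHom := by
    refine tpow_addHom_ext fun r hr m => ?_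
    change _ = TPow.act k h (r • pureY X m)
    rw [psi_monomial hr, act_monomial, Nat.div_self (Nat.pos_of_ne_zero (index_ne_zero V)), pow_one]
    congr 2
    funext y
    congr 1
    conv_rhs => rw [← QuotientGroup.out_eq' y]
    rfl
  exact DFunLike.congr_fun this n

/-- If the trace of `n` over the Weyl group of `V` vanishes, then so do all the additive ghost
components of `n`: they are invariant under the Weyl group and take values in torsion-free
groups. -/
theorem theta_eq_zero_of_self (n : TPow (freeModPair X Y) (Cosets V))
    (h : theta X Y H V V n = 0) : theta X Y H V U n = 0 := by
  have h1 : theta X Y H V U (∑ z ∈ fixedFinset H V V,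
      psi X Y (V.toSubgroup.index / V.toSubgroup.index) (fun y : Cosets V => y.out • z) n) = 0 := by
    rw [← AddMonoidHom.finsetSum_apply, ← theta, h, map_zero]
  rw [map_sum] at h1
  rw [Finset.sum_congr rfl (g := fun _ => theta X Y H V U n), Finset.sum_const] at h1
  · refine tpow_nsmul_eq_zero (Finset.card_ne_zero_of_mem (a := QuotientGroup.mk 1) ?_) h1
    rw [mem_fixedFinset, mk_mem_fixedSet H.one_mem, inv_one, conj_one]
  · intro z hz
    obtain ⟨g, hg, hgV, hpsi⟩ := exists_act_eq_psi (X := X) (Y := Y) (mem_fixedFinset.mp hz)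
    rw [hpsi, theta_act hg]

end Theta

/-! ### The span of the additive ghost components -/

section Span

variable {G : Type u} [Group G] [TopologicalSpace G] [IsTopologicalGroup G] [CompactSpace G]
  {H : OpenSubgroup G} (S : TruncationSet H) (X Y : Type u)

/-- The family of all additive ghost components of `n ∈ M^{⊗ G/V}`, for `V ∈ S`. -/
def thetaFam (V : S.carrier) : TPow (freeModPair X Y) (Cosets V.1) →+
    ∀ U : S.carrier, TPow (freeModPair X Y) (Cosets U.1) :=
  AddMonoidHom.mk' (fun n U => theta X Y H V.1 U.1 n) fun a b => funext fun _ => map_add _ a b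

/-- The subgroup of `∏_{U ∈ S} M^{⊗ G/U}` generated by the families `thetaFam V n`. -/
def thetaSpan : AddSubgroup (∀ U : S.carrier, TPow (freeModPair X Y) (Cosets U.1)) :=
  AddSubgroup.closure {x | ∃ V n, thetaFam S X Y V n = x}

/-- The closure of `thetaSpan` in the product topology. It will turn out to be the image of the
ghost map, for every choice of representatives. -/
def ghostSpan : AddSubgroup (∀ U : S.carrier, TPow (freeModPair X Y) (Cosets U.1)) where
  carrier := {x | ∀ 𝓕 : Finset S.carrier, ∃ d ∈ thetaSpan S X Y, ∀ U ∈ 𝓕, d U = x U}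
  zero_mem' _ := ⟨0, zero_mem _, fun _ _ => rfl⟩
  add_mem' {x y} hx hy 𝓕 := by
    obtain ⟨d, hd, hdx⟩ := hx 𝓕
    obtain ⟨e, he, hey⟩ := hy 𝓕
    exact ⟨d + e, add_mem hd he, fun U hU => by
      rw [Pi.add_apply, Pi.add_apply, hdx U hU, hey U hU]⟩
  neg_mem' {x} hx 𝓕 := by
    obtain ⟨d, hd, hdx⟩ := hx 𝓕
    exact ⟨-d, neg_mem hd, fun U hU => by rw [Pi.neg_apply, Pi.neg_apply, hdx U hU]⟩

variable {S X Y}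

theorem mem_ghostSpan_of_forall {x : ∀ U : S.carrier, TPow (freeModPair X Y) (Cosets U.1)}
    (h : ∀ 𝓕 : Finset S.carrier, ∃ d ∈ ghostSpan S X Y, ∀ U ∈ 𝓕, d U = x U) :
    x ∈ ghostSpan S X Y := by
  intro 𝓕
  obtain ⟨d, hd, hdx⟩ := h 𝓕
  obtain ⟨e, he, hed⟩ := hd 𝓕
  exact ⟨e, he, fun U hU => (hed U hU).trans (hdx U hU)⟩

theorem ghostSpan_le_ghostSubgroup :
    ghostSpan S X Y ≤ ghostSubgroup S (freeModPair X Y) := by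
  classical
  have h1 : thetaSpan S X Y ≤ ghostSubgroup S (freeModPair X Y) := by
    refine (AddSubgroup.closure_le _).mpr ?_
    rintro _ ⟨V, n, rfl⟩ a ha U U' h
    exact act_theta ha h n
  intro x hx a ha U U' h
  obtain ⟨d, hd, hdx⟩ := hx {U, U'}
  rw [← hdx U (by simp), ← hdx U' (by simp)]
  exact h1 hd a ha U U' h

/-! ### Weighted sets -/

/-- The stabiliser in `H` of a point of a `G`-set that is fixed by some open subgroup. -/
def openStabilizer {A : Type*} [MulAction G A] (H : OpenSubgroup G) (a : A) (U : OpenSubgroup G)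
    (hU : U ≤ H) (hfix : ∀ u ∈ U, u • a = a) : OpenSubgroup G :=
  ⟨H.toSubgroup ⊓ MulAction.stabilizer G a,
    Subgroup.isOpen_mono (H₁ := U.toSubgroup) (fun u hu => ⟨hU hu, hfix u hu⟩) U.isOpen⟩

/-- The contribution of a single orbit to the weighted count of fixed points: if `W` is the
stabiliser of `a` in `H`, then the `U`-fixed points of the orbit `H a ≅ H / W`, weighted by scalars
`ρ` and vectors `μ`, sum up to the value of `theta` on the weight of `a` at `W`. -/
theorem theta_orbit {A : Type*} [MulAction G A] (a : A)
    (ρ : A → OpenSubgroup G → (freeModPair X Y).ring) (μ : A → G → (freeModPair X Y).mod)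
    {W U : OpenSubgroup G} (hU : U ≤ H) (hW : ∀ g, g ∈ W ↔ g ∈ H ∧ g • a = a)
    (hρ : ρ a W ∈ monomials X Y)
    (hρc : ∀ (h : G) (U : OpenSubgroup G), (∀ u ∈ U, u • a = a) → ρ (h • a) (conj h U) = ρ a U)
    (hρp : ∀ U, U ≤ W → ρ a U = ρ a W ^ (U.toSubgroup.index / W.toSubgroup.index))
    (hμ : ∀ h g, μ (h • a) g = μ a (g * h)) (hμY : ∀ g, ∃ y, μ a g = freeY X y) :
    theta X Y H W U (ρ a W • TPow.tprod _ fun y : Cosets W => μ a y.out) =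
      ∑ᶠ a' ∈ fixedIn {a' | ∃ h ∈ H, h • a = a'} U,
        ρ a' U • TPow.tprod _ fun y : Cosets U => μ a' y.out := by
  choose m hm using hμY
  have hpure : TPow.tprod (freeModPair X Y) (fun y : Cosets W => μ a y.out)
      = pureY X fun y : Cosets W => m y.out := by
    rw [pureY]
    congr 1
    funext y
    exact hm _
  have hout : ∀ g : G, ∃ w ∈ W, (QuotientGroup.mk g : Cosets W).out = g * w := by
    intro g
    refine ⟨g⁻¹ * (QuotientGroup.mk g : Cosets W).out, ?_, by group⟩
    exact QuotientGroup.eq.mp (QuotientGroup.out_eq' (QuotientGroup.mk g : Cosets W)).symm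
  have houtH : ∀ z ∈ fixedSet H W U, z.out ∈ H := by
    rintro _ ⟨⟨k, hk, rfl⟩, -⟩
    obtain ⟨w, hw, h⟩ := hout k
    rw [h]
    exact H.mul_mem hk ((hW w).mp hw).1
  rw [hpure, theta_monomial hρ, ← finsum_mem_coe_finset]
  refine finsum_mem_eq_of_bijOn (fun z => z.out • a) ⟨?_, ?_, ?_⟩ ?_
  · intro z hz
    have hz := mem_fixedFinset.mp hz
    refine ⟨⟨_, houtH z hz, rfl⟩, fun u hu => ?_⟩
    have h1 : (QuotientGroup.mk z.out : Cosets W) ∈ fixedSet H W U := by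
      rwa [QuotientGroup.out_eq']
    have h2 := (mk_mem_fixedSet (houtH z hz)).mp h1
      (show z.out⁻¹ * u * z.out ∈ conj z.out⁻¹ U from mem_conj.mpr (by simpa [mul_assoc] using hu))
    have h3 := ((hW _).mp h2).2
    rwa [mul_smul, mul_smul, inv_smul_eq_iff] at h3
  · intro z hz z' hz' h
    have hz := mem_fixedFinset.mp hz
    have hz' := mem_fixedFinset.mp hz'
    rw [← QuotientGroup.out_eq' z, ← QuotientGroup.out_eq' z', QuotientGroup.eq]
    refine (hW _).mpr ⟨H.mul_mem (H.inv_mem (houtH z hz)) (houtH z' hz'), ?_⟩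
    rw [mul_smul, inv_smul_eq_iff]
    exact h.symm
  · rintro _ ⟨⟨h, hh, rfl⟩, hfix⟩
    obtain ⟨w, hw, hhw⟩ := hout h
    refine ⟨QuotientGroup.mk h, mem_fixedFinset.mpr ((mk_mem_fixedSet hh).mpr fun u hu => ?_), ?_⟩
    · rw [mem_conj, inv_inv] at hu
      refine (hW u).mpr ⟨?_, ?_⟩
      · have := H.mul_mem (H.mul_mem (H.inv_mem hh) (hU hu)) hh
        simpa [mul_assoc] using this
      · have := hfix _ hu
        rw [mul_smul, mul_smul, inv_smul_smul] at this
        exact MulAction.injective h this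
    · dsimp only
      rw [hhw, mul_smul, ((hW w).mp hw).2]
  · intro z hz
    have hz := mem_fixedFinset.mp hz
    have h1 : (QuotientGroup.mk z.out : Cosets W) ∈ fixedSet H W U := by
      rwa [QuotientGroup.out_eq']
    have h2 := (mk_mem_fixedSet (houtH z hz)).mp h1
    have h3 : ρ (z.out • a) U = ρ a W ^ (U.toSubgroup.index / W.toSubgroup.index) := by
      rw [← index_conj z.out⁻¹ U, ← hρp _ h2, ← hρc z.out _ fun u hu => ((hW u).mp (h2 hu)).2,
        conj_conj_inv]
    rw [h3, pureY]
    congr 2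
    funext y
    rw [hμ, ← hm]
    obtain ⟨w, hw, h4⟩ := hout (y.out * z.out)
    have h5 : y.out • z = QuotientGroup.mk (y.out * z.out) := by
      conv_lhs => rw [← QuotientGroup.out_eq' z]
      rfl
    rw [h5, h4, ← hμ, ((hW w).mp hw).2]

/-- The weighted counts of fixed points of an `H`-stable subset of a `G`-set, with monomial weights,
form a family in the closure of the span of the additive ghost components: decompose the set into
orbits. -/
theorem weighted_mem_ghostSpan {A : Type*} [MulAction G A]
    (ρ : A → OpenSubgroup G → (freeModPair X Y).ring) (μ : A → G → (freeModPair X Y).mod)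
    (A₀ : Set A) (hA₀ : ∀ h ∈ H, ∀ a ∈ A₀, h • a ∈ A₀)
    (hfin : ∀ U ∈ S.carrier, (fixedIn A₀ U).Finite)
    (hρ : ∀ a ∈ A₀, ∀ U, ρ a U ∈ monomials X Y)
    (hρc : ∀ a ∈ A₀, ∀ (h : G) (U : OpenSubgroup G), (∀ u ∈ U, u • a = a) →
      ρ (h • a) (conj h U) = ρ a U)
    (hρp : ∀ a ∈ A₀, ∀ U U' : OpenSubgroup G, U ≤ U' → (∀ u ∈ U', u • a = a) →
      ρ a U = ρ a U' ^ (U.toSubgroup.index / U'.toSubgroup.index))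
    (hμ : ∀ a h g, μ (h • a) g = μ a (g * h)) (hμY : ∀ a ∈ A₀, ∀ g, ∃ y, μ a g = freeY X y) :
    (fun U : S.carrier => ∑ᶠ a ∈ fixedIn A₀ U.1,
      ρ a U.1 • TPow.tprod (freeModPair X Y) fun y : Cosets U.1 => μ a y.out) ∈
        ghostSpan S X Y := by
  intro 𝓕
  have hUfin : ∀ A₁ ⊆ A₀, (⋃ U ∈ 𝓕, fixedIn A₁ U.1).Finite := by
    intro A₁ h1
    refine Set.Finite.subset (s := ⋃ U ∈ 𝓕, fixedIn A₀ U.1)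
      (𝓕.finite_toSet.biUnion fun U _ => hfin U.1 U.2) ?_
    exact Set.iUnion₂_mono fun U _ a ha => ⟨h1 ha.1, ha.2⟩
  suffices key : ∀ (N : ℕ) (A₁ : Set A), A₁ ⊆ A₀ → (∀ h ∈ H, ∀ a ∈ A₁, h • a ∈ A₁) →
      (⋃ U ∈ 𝓕, fixedIn A₁ U.1).ncard = N → ∃ d ∈ thetaSpan S X Y, ∀ U ∈ 𝓕,
        d U = ∑ᶠ a ∈ fixedIn A₁ U.1,
          ρ a U.1 • TPow.tprod (freeModPair X Y) fun y : Cosets U.1 => μ a y.out from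
    key _ A₀ subset_rfl hA₀ rfl
  intro N
  induction N using Nat.strong_induction_on with
  | _ N ih =>
    intro A₁ hsub hstab hN
    by_cases hemp : (⋃ U ∈ 𝓕, fixedIn A₁ U.1) = ∅
    · refine ⟨0, zero_mem _, fun U hU => ?_⟩
      have : fixedIn A₁ U.1 = ∅ := by
        rw [Set.eq_empty_iff_forall_notMem] at hemp ⊢
        exact fun a ha => hemp a (Set.mem_biUnion hU ha)
      rw [this, finsum_mem_empty]
      rfl
    obtain ⟨a, ha⟩ := Set.nonempty_iff_ne_empty.mpr hemp
    obtain ⟨U₀, hU₀, haU₀⟩ := Set.mem_iUnion₂.mp ha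
    let O : Set A := {a' | ∃ h ∈ H, h • a = a'}
    let A₂ : Set A := A₁ \ O
    have hO : O ⊆ A₁ := by
      rintro _ ⟨h, hh, rfl⟩
      exact hstab h hh a haU₀.1
    have hA₂ : ∀ h ∈ H, ∀ b ∈ A₂, h • b ∈ A₂ := by
      rintro h hh b ⟨hb, hbO⟩
      refine ⟨hstab h hh b hb, ?_⟩
      rintro ⟨h', hh', he⟩
      refine hbO ⟨h⁻¹ * h', H.mul_mem (H.inv_mem hh) hh', ?_⟩
      rw [mul_smul, he, inv_smul_smul]
    have hlt : (⋃ U ∈ 𝓕, fixedIn A₂ U.1).ncard < N := by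
      rw [← hN]
      refine Set.ncard_lt_ncard ?_ (hUfin A₁ hsub)
      refine (Set.ssubset_iff_of_subset ?_).mpr ⟨a, ha, ?_⟩
      · exact Set.iUnion₂_mono fun U _ b hb => ⟨hb.1.1, hb.2⟩
      · intro h
        obtain ⟨U, _, hU⟩ := Set.mem_iUnion₂.mp h
        exact hU.1.2 ⟨1, H.one_mem, one_smul G a⟩
    obtain ⟨d, hd, hdU⟩ := ih _ hlt A₂ (Set.sdiff_subset.trans hsub) hA₂ rfl
    have haA := hsub haU₀.1
    let W := openStabilizer H a U₀.1 (S.le _ U₀.2) haU₀.2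
    have hWmem : ∀ g, g ∈ W ↔ g ∈ H ∧ g • a = a := fun g => Iff.rfl
    have hWS : W ∈ S.carrier := S.upward _ U₀.2 W
      (fun u hu => ⟨S.le _ U₀.2 hu, haU₀.2 u hu⟩) fun w hw => hw.1
    refine ⟨d + thetaFam S X Y ⟨W, hWS⟩ (ρ a W • TPow.tprod _ fun y : Cosets W => μ a y.out),
      add_mem hd (AddSubgroup.subset_closure ⟨_, _, rfl⟩), fun U hU => ?_⟩
    have hunion : fixedIn A₁ U.1 = fixedIn A₂ U.1 ∪ fixedIn O U.1 := by
      ext b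
      constructor
      · rintro ⟨hb, hfix⟩
        by_cases hbO : b ∈ O
        · exact Or.inr ⟨hbO, hfix⟩
        · exact Or.inl ⟨⟨hb, hbO⟩, hfix⟩
      · rintro (⟨hb, hfix⟩ | ⟨hb, hfix⟩)
        · exact ⟨hb.1, hfix⟩
        · exact ⟨hO hb, hfix⟩
    have hdisj : Disjoint (fixedIn A₂ U.1) (fixedIn O U.1) :=
      Set.disjoint_left.mpr fun b hb hb' => hb.1.2 hb'.1
    have hfinU := hfin U.1 U.2
    rw [hunion, finsum_mem_union hdisj
      (hfinU.subset fun b hb => ⟨hsub hb.1.1, hb.2⟩)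
      (hfinU.subset fun b hb => ⟨hsub (hO hb.1), hb.2⟩), Pi.add_apply, hdU U hU]
    congr 1
    exact theta_orbit a ρ μ (S.le _ U.2) hWmem (hρ a haA W) (hρc a haA)
      (fun U' hU' => hρp a haA U' W hU' fun w hw => hw.2) (hμ a) (hμY a haA)

theorem tau_mem_ghostSpan_of_isPos {V : OpenSubgroup G} (σ : Cosets V → G)
    (hσ : ∀ x, (QuotientGroup.mk (σ x) : Cosets V) = x)
    {n : TPow (freeModPair X Y) (Cosets V)} (hn : IsPos n) :
    (fun U : S.carrier => tau σ hσ n (S.le U.1 U.2)) ∈ ghostSpan S X Y := by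
  obtain ⟨ι, _, r, m, hr, rfl⟩ := hn
  have := weighted_mem_ghostSpan (S := S) (X := X) (Y := Y)
    (fun (a : Coloring V ι) U => a.scalar r U)
    (fun a g => a.vector σ (fun i z => freeY X (m i z)) g) (Coloring.total H V ι)
    (fun h hh a ha => Coloring.smul_mem_total hh ha)
    (fun U hU => Coloring.finite_fixedIn (S.le U hU))
    (fun a _ U => Coloring.scalar_mem a _ hr)
    (fun a _ h U hfix => Coloring.scalar_smul a h U hfix)
    (fun a _ U U' hUU' hfix => Coloring.scalar_eq_pow a hUU' hfix)
    (fun a h g => Coloring.vector_smul σ _ a h g)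
    (fun a ha g => by
      obtain ⟨i, z, h⟩ := Coloring.exists_vector_eq hσ (fun i z => freeY X (m i z)) ha g
      exact ⟨_, h⟩)
  convert! this using 2 with U
  rw [← finsum_set_coe_eq_finsum_mem]
  exact tau_sum (S.le U.1 U.2) r fun i z => freeY X (m i z)

/-- Every contribution to the ghost map lies in the closure of the span of the additive ghost
components. For differences of sums of monomials this follows by extrapolation, as the contribution
of `p + t q` is polynomial in `t`. -/
theorem tau_mem_ghostSpan {V : OpenSubgroup G} (σ : Cosets V → G)
    (hσ : ∀ x, (QuotientGroup.mk (σ x) : Cosets V) = x)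
    (n : TPow (freeModPair X Y) (Cosets V)) :
    (fun U : S.carrier => tau σ hσ n (S.le U.1 U.2)) ∈ ghostSpan S X Y := by
  obtain ⟨p, q, hp, hq, rfl⟩ := exists_isPos_sub n
  refine mem_ghostSpan_of_forall fun 𝓕 => ?_
  obtain ⟨N, c, hc⟩ := IsPoly.exists_extrapolation 𝓕
    (fun (U : S.carrier) (t : ℤ) => tau σ hσ (p + t • q) (S.le U.1 U.2))
    (fun U _ => isPoly_tau (S.le U.1 U.2) p q)
  refine ⟨∑ k ∈ Finset.range N, c k •
    (fun U : S.carrier => tau σ hσ (p + k • q) (S.le U.1 U.2)), ?_, fun U hU => ?_⟩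
  · exact AddSubgroup.sum_mem _ fun k _ => AddSubgroup.zsmul_mem _
      (tau_mem_ghostSpan_of_isPos σ hσ (hp.add (hq.nsmul k))) _
  · have := hc U hU
    simp only [neg_smul, one_smul, ← sub_eq_add_neg, natCast_zsmul] at this
    rw [this, Finset.sum_apply]
    rfl

end Span

/-! ### The ghost map -/

section Ghost

variable {G : Type u} [Group G] [TopologicalSpace G] [IsTopologicalGroup G] [CompactSpace G]
  {H : OpenSubgroup G} {S : TruncationSet H} (c : Choices S)

theorem fixedSet_nonempty_iff {H V U : OpenSubgroup G} :
    (fixedSet H V U).Nonempty ↔ ∃ k ∈ H, U ≤ conj k V := by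
  have key : ∀ k : G, conj k⁻¹ U ≤ V ↔ U ≤ conj k V := fun k =>
    ⟨fun h => by simpa [conj_conj_inv] using conj_mono k h,
      fun h => by simpa [conj_conj, conj_one] using conj_mono k⁻¹ h⟩
  constructor
  · rintro ⟨z, hz⟩
    obtain ⟨k, hk, rfl⟩ := hz.1
    exact ⟨k, hk, (key k).mp ((mk_mem_fixedSet hk).mp hz)⟩
  · rintro ⟨k, hk, h⟩
    exact ⟨_, (mk_mem_fixedSet hk).mpr ((key k).mpr h)⟩

theorem fixedSet_nonempty_trans {H V U W : OpenSubgroup G} (h : (fixedSet H V U).Nonempty)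
    (h' : (fixedSet H U W).Nonempty) : (fixedSet H V W).Nonempty := by
  rw [fixedSet_nonempty_iff] at *
  obtain ⟨k, hk, h⟩ := h
  obtain ⟨l, hl, h'⟩ := h'
  exact ⟨l * k, H.mul_mem hl hk, h'.trans (by rw [← conj_conj]; exact conj_mono l h)⟩

theorem index_le_of_fixedSet_nonempty {H V U : OpenSubgroup G} (h : (fixedSet H V U).Nonempty) :
    V.toSubgroup.index ≤ U.toSubgroup.index := by
  obtain ⟨k, hk, h⟩ := fixedSet_nonempty_iff.mp h
  rw [← index_conj k V]
  rcases h.eq_or_lt with h | h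
  · rw [h]
  · exact (index_lt_of_lt h).le

theorem fixedSet_self_nonempty {H V : OpenSubgroup G} : (fixedSet H V V).Nonempty :=
  fixedSet_nonempty_iff.mpr ⟨1, H.one_mem, (conj_one V).ge⟩

theorem Choices.exists_conj_mem_reps (c : Choices S) (U : S.carrier) :
    ∃ (V : c.reps) (h : G), h ∈ H ∧ conj h U.1 = V.1 := by
  obtain ⟨V, ⟨hV, h, hh, e⟩, -⟩ := c.existsUnique_rep U.1 U.2
  exact ⟨⟨V, hV⟩, h, hh, e⟩

theorem Choices.eq_of_conj {V W : c.reps} {h : G} (hh : h ∈ H) (e : conj h V.1 = W.1) : V = W := by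
  obtain ⟨Z, -, hZ⟩ := c.existsUnique_rep V.1 (c.reps_subset V.2)
  exact Subtype.ext ((hZ V.1 ⟨V.2, 1, H.one_mem, conj_one V.1⟩).trans
    (hZ W.1 ⟨W.2, h, hh, e⟩).symm)

theorem Choices.index_lt {V W : c.reps} (h : (fixedSet H V.1 W.1).Nonempty) (hne : V ≠ W) :
    V.1.toSubgroup.index < W.1.toSubgroup.index := by
  refine (index_le_of_fixedSet_nonempty h).lt_of_ne fun hi => hne ?_
  obtain ⟨k, hk, h⟩ := fixedSet_nonempty_iff.mp h
  exact c.eq_of_conj hk (eq_of_le_of_index_le h (by rw [index_conj, hi])).symm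

theorem Choices.finite_support (U : S.carrier) :
    {V : c.reps | (fixedSet H V.1 U.1).Nonempty}.Finite := by
  have h : ∀ V : c.reps, ∃ k : G, (fixedSet H V.1 U.1).Nonempty → k ∈ H ∧ U.1 ≤ conj k V.1 := by
    intro V
    by_cases hV : (fixedSet H V.1 U.1).Nonempty
    · obtain ⟨k, hk⟩ := fixedSet_nonempty_iff.mp hV
      exact ⟨k, fun _ => hk⟩
    · exact ⟨1, fun h => absurd h hV⟩
  choose k hk using h
  refine Set.Finite.of_injOn (f := fun V : c.reps => conj (k V) V.1)
    (t := {W | U.1 ≤ W}) (fun V hV => (hk V hV).2) (fun V hV W hW e => ?_) (finite_overgroups U.1)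
  refine c.eq_of_conj (h := (k W)⁻¹ * k V)
    (H.mul_mem (H.inv_mem (hk W hW).1) (hk V hV).1) ?_
  dsimp only at e
  rw [← conj_conj, e, conj_conj, inv_mul_cancel, conj_one]

/-- The finitely many distinguished subgroups to which `U` is subconjugate. -/
def Choices.support (U : S.carrier) : Finset c.reps := (c.finite_support U).toFinset

theorem Choices.mem_support {U : S.carrier} {V : c.reps} :
    V ∈ c.support U ↔ (fixedSet H V.1 U.1).Nonempty :=
  Set.Finite.mem_toFinset _

theorem Choices.ghost_eq_finsum {P : ModPair.{u}} (n : ∀ V : c.reps, TPow P (Cosets V.1))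
    (U : S.carrier) :
    c.ghost n U = ∑ᶠ V : c.reps, tau (c.sec V) (c.mk_sec V) (n V) (S.le U.1 U.2) := rfl

theorem Choices.ghost_eq_sum {P : ModPair.{u}} (n : ∀ V : c.reps, TPow P (Cosets V.1))
    (U : S.carrier) (s : Finset c.reps) (hs : c.support U ⊆ s) :
    c.ghost n U = ∑ V ∈ s, tau (c.sec V) (c.mk_sec V) (n V) (S.le U.1 U.2) := by
  rw [Choices.ghost_eq_finsum]
  refine finsum_eq_sum_of_support_subset _ fun V hV => hs ?_
  rw [c.mem_support]
  by_contra h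
  exact hV (tau_eq_zero _ h _)

theorem Choices.ghost_congr {P : ModPair.{u}} {n n' : ∀ V : c.reps, TPow P (Cosets V.1)}
    {U : S.carrier} (h : ∀ V ∈ c.support U, n V = n' V) : c.ghost n U = c.ghost n' U := by
  rw [c.ghost_eq_sum n U _ subset_rfl, c.ghost_eq_sum n' U _ subset_rfl]
  exact Finset.sum_congr rfl fun V hV => by rw [h V hV]

/-- The map induced on coordinates by a morphism of `Mod`. -/
def Choices.coordMap {P Q : ModPair.{u}} (f : P ⟶ Q) (n : ∀ V : c.reps, TPow P (Cosets V.1))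
    (V : c.reps) : TPow Q (Cosets V.1) :=
  TPow.map _ f (n V)

/-- Naturality of the ghost map. -/
theorem Choices.map_ghost {P Q : ModPair.{u}} (f : P ⟶ Q) (n : ∀ V : c.reps, TPow P (Cosets V.1))
    (U : S.carrier) :
    TPow.map _ f (c.ghost n U) = c.ghost (c.coordMap f n) U := by
  rw [c.ghost_eq_sum _ U _ subset_rfl, c.ghost_eq_sum _ U _ subset_rfl, map_sum]
  exact Finset.sum_congr rfl fun V _ => map_tau _ f _

theorem Choices.continuous_ghost {P : ModPair.{u}} :
    Continuous (c.ghost : (∀ V : c.reps, TPow P (Cosets V.1)) →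
      ∀ U : S.carrier, TPow P (Cosets U.1)) := by
  refine continuous_pi fun U => ?_
  simp only [fun n => c.ghost_eq_sum (P := P) n U _ subset_rfl]
  refine continuous_finsetSum _ fun V _ => ?_
  exact (continuous_of_discreteTopology (f := fun m : TPow P (Cosets V.1) =>
    tau (c.sec V) (c.mk_sec V) m (S.le U.1 U.2))).comp (continuous_apply V)

theorem act_injective_ghost {P : ModPair.{u}} {x y : ∀ U : S.carrier, TPow P (Cosets U.1)}
    (hx : x ∈ ghostSubgroup S P) (hy : y ∈ ghostSubgroup S P) {h : G} (hh : h ∈ H)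
    {U V : S.carrier} (e : conj h U.1 = V.1) : x U = y U ↔ x V = y V := by
  rw [← hx h hh U V e, ← hy h hh U V e, EmbeddingLike.apply_eq_iff_eq]

variable (X Y : Type u)

/-- The additive analogue of the ghost map: the sum of the additive ghost components. -/
def Choices.additiveGhost : (∀ V : c.reps, TPow (freeModPair X Y) (Cosets V.1)) →+
    ∀ U : S.carrier, TPow (freeModPair X Y) (Cosets U.1) :=
  AddMonoidHom.mk' (fun n U => ∑ V ∈ c.support U, theta X Y H V.1 U.1 (n V)) fun a b => by
    funext U
    simp [Finset.sum_add_distrib]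

variable {X Y}

theorem Choices.additiveGhost_apply (n : ∀ V : c.reps, TPow (freeModPair X Y) (Cosets V.1))
    (U : S.carrier) :
    c.additiveGhost X Y n U = ∑ V ∈ c.support U, theta X Y H V.1 U.1 (n V) := rfl

theorem Choices.additiveGhost_mem (n : ∀ V : c.reps, TPow (freeModPair X Y) (Cosets V.1)) :
    c.additiveGhost X Y n ∈ ghostSubgroup S (freeModPair X Y) := by
  intro a ha U U' h
  have hsupp : c.support U = c.support U' := by
    ext V
    rw [c.mem_support, c.mem_support, fixedSet_nonempty_iff, fixedSet_nonempty_iff]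
    constructor
    · rintro ⟨k, hk, hle⟩
      exact ⟨a * k, H.mul_mem ha hk, by rw [← h, ← conj_conj]; exact conj_mono a hle⟩
    · rintro ⟨k, hk, hle⟩
      refine ⟨a⁻¹ * k, H.mul_mem (H.inv_mem ha) hk, ?_⟩
      have := conj_mono a⁻¹ hle
      rwa [← h, conj_conj, conj_conj, inv_mul_cancel, conj_one] at this
  rw [c.additiveGhost_apply, c.additiveGhost_apply, map_sum, hsupp]
  exact Finset.sum_congr rfl fun V _ => act_theta ha h _

theorem Choices.thetaSpan_le : thetaSpan S X Y ≤ (c.additiveGhost X Y).range := by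
  classical
  refine (AddSubgroup.closure_le _).mpr ?_
  rintro _ ⟨V, n, rfl⟩
  obtain ⟨V', h, hh, e⟩ := c.exists_conj_mem_reps V
  refine ⟨Pi.single V' (TPow.act h e n), funext fun U => ?_⟩
  rw [c.additiveGhost_apply]
  change _ = theta X Y H V.1 U.1 n
  rw [← theta_act hh e]
  by_cases hV : V' ∈ c.support U
  · rw [Finset.sum_eq_single_of_mem V' hV fun W _ hW => by rw [Pi.single_eq_of_ne hW, map_zero],
      Pi.single_eq_same]
  · rw [theta_eq_zero (fun hne => hV (c.mem_support.mpr hne)), Finset.sum_eq_zero]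
    · rfl
    · intro W hW
      rw [Pi.single_eq_of_ne (by rintro rfl; exact hV hW), map_zero]

/-- The element of `S` underlying a distinguished subgroup. -/
abbrev Choices.toS (V : c.reps) : S.carrier := ⟨V.1, c.reps_subset V.2⟩

/-- If a family in the closure of the span vanishes at all proper overgroups of `V`, then its value
at `V` is a trace over the Weyl group of `V`. -/
theorem Choices.exists_theta_eq (V : c.reps)
    {y : ∀ U : S.carrier, TPow (freeModPair X Y) (Cosets U.1)} (hy : y ∈ ghostSpan S X Y)
    (h0 : ∀ U : S.carrier, V.1 < U.1 → y U = 0) :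
    ∃ n, theta X Y H V.1 V.1 n = y (c.toS V) := by
  have hfin : {U : S.carrier | V.1 ≤ U.1}.Finite :=
    Set.Finite.of_finite_image ((finite_overgroups V.1).subset (by
      rintro _ ⟨U, hU, rfl⟩
      exact hU)) Subtype.val_injective.injOn
  obtain ⟨d, hd, hdy⟩ := hy hfin.toFinset
  obtain ⟨n, rfl⟩ := c.thetaSpan_le hd
  have hdy : ∀ U : S.carrier, V.1 ≤ U.1 → c.additiveGhost X Y n U = y U := fun U hU =>
    hdy U ((Set.Finite.mem_toFinset _).mpr hU)
  -- the summands of all distinguished subgroups properly above `V` vanish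
  have key : ∀ (N : ℕ) (V' : c.reps), V'.1.toSubgroup.index = N → V' ≠ V →
      (fixedSet H V'.1 V.1).Nonempty → ∀ U, theta X Y H V'.1 U (n V') = 0 := by
    intro N
    induction N using Nat.strong_induction_on with
    | _ N ih =>
      rintro V' rfl hne hV' U
      refine theta_eq_zero_of_self _ ?_
      obtain ⟨k, hk, hle⟩ := fixedSet_nonempty_iff.mp hV'
      let U' : S.carrier := ⟨conj k V'.1, S.conj_mem _ (c.reps_subset V'.2) k hk⟩
      have hlt : V.1 < U'.1 := hle.lt_of_ne fun e => hne (c.eq_of_conj hk e.symm)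
      have h1 : c.additiveGhost X Y n U' = 0 := by rw [hdy U' hle, h0 U' hlt]
      have h2 : c.additiveGhost X Y n (c.toS V') = 0 :=
        (act_injective_ghost (c.additiveGhost_mem n) (zero_mem _) hk
          (rfl : conj k (c.toS V').1 = U'.1)).mpr h1
      rw [c.additiveGhost_apply, Finset.sum_eq_single_of_mem V'
        (c.mem_support.mpr fixedSet_self_nonempty)] at h2
      · exact h2
      · intro V'' hV'' hne'
        have hs := c.mem_support.mp hV''
        have hlt' := c.index_lt hs hne'
        refine ih _ hlt' V'' rfl ?_ (fixedSet_nonempty_trans hs hV') _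
        rintro rfl
        exact absurd (c.index_lt hV' hne) (by omega)
  -- at the level of `V` only the summand of `V` is left
  refine ⟨n V, ?_⟩
  rw [← hdy (c.toS V) le_rfl, c.additiveGhost_apply, Finset.sum_eq_single_of_mem V
    (c.mem_support.mpr fixedSet_self_nonempty)]
  exact fun V' hV' hne => key _ V' rfl hne (c.mem_support.mp hV') _

theorem Choices.ghost_mem_ghostSpan (n : ∀ V : c.reps, TPow (freeModPair X Y) (Cosets V.1)) :
    c.ghost n ∈ ghostSpan S X Y := by
  classical
  refine mem_ghostSpan_of_forall fun 𝓕 => ?_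
  refine ⟨∑ V ∈ 𝓕.biUnion c.support, fun U : S.carrier =>
    tau (c.sec V) (c.mk_sec V) (n V) (S.le U.1 U.2), ?_, fun U hU => ?_⟩
  · exact AddSubgroup.sum_mem _ fun V _ => tau_mem_ghostSpan _ _ _
  · rw [c.ghost_eq_sum n U _ (Finset.subset_biUnion_of_mem c.support hU), Finset.sum_apply]

/-- The family `n`, with the components at subgroups of index at least `N` replaced by zero. -/
def Choices.truncate {P : ModPair.{u}} (N : ℕ) (n : ∀ V : c.reps, TPow P (Cosets V.1)) :
    ∀ V : c.reps, TPow P (Cosets V.1) :=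
  fun V => if V.1.toSubgroup.index < N then n V else 0

theorem Choices.ghost_truncate {P : ModPair.{u}} {N : ℕ}
    (n : ∀ V : c.reps, TPow P (Cosets V.1)) {U : S.carrier} (hU : U.1.toSubgroup.index < N) :
    c.ghost (c.truncate N n) U = c.ghost n U :=
  c.ghost_congr fun _ hV =>
    if_pos ((index_le_of_fixedSet_nonempty (c.mem_support.mp hV)).trans_lt hU)

theorem Choices.ghost_self (n : ∀ V : c.reps, TPow (freeModPair X Y) (Cosets V.1)) (V : c.reps) :
    c.ghost n (c.toS V) = c.ghost (c.truncate V.1.toSubgroup.index n) (c.toS V)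
      + theta X Y H V.1 (c.toS V).1 (n V) := by
  classical
  have hV : V ∈ c.support (c.toS V) := c.mem_support.mpr fixedSet_self_nonempty
  rw [c.ghost_eq_sum n _ _ subset_rfl, c.ghost_eq_sum _ _ _ subset_rfl,
    ← Finset.sum_erase_add _ _ hV, ← Finset.sum_erase_add _ _ hV]
  have h1 : ∀ m, tau (c.sec V) (c.mk_sec V) m (S.le (c.toS V).1 (c.toS V).2)
      = theta X Y H V.1 V.1 m := tau_self _
  rw [h1, h1, Choices.truncate, if_neg (lt_irrefl _), map_zero, add_zero]
  congr 1
  refine Finset.sum_congr rfl fun W hW => ?_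
  rw [Finset.mem_erase] at hW
  rw [Choices.truncate, if_pos (c.index_lt (c.mem_support.mp hW.2) hW.1)]

open Classical in
/-- A section of the trace over the Weyl group of `V`, extended by zero to all tensors. -/
def traceSection (X Y : Type u) (H V : OpenSubgroup G)
    (y : TPow (freeModPair X Y) (Cosets V)) : TPow (freeModPair X Y) (Cosets V) :=
  if h : ∃ n, theta X Y H V V n = y then h.choose else 0

theorem theta_traceSection {V : OpenSubgroup G} {y : TPow (freeModPair X Y) (Cosets V)}
    (h : ∃ n, theta X Y H V V n = y) : theta X Y H V V (traceSection X Y H V y) = y := by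
  rw [traceSection, dif_pos h]
  exact h.choose_spec

/-- The components of a continuous section of the ghost map over its image, by recursion on the
index of the subgroup. -/
def Choices.ghostSection (x : ∀ U : S.carrier, TPow (freeModPair X Y) (Cosets U.1)) (V : c.reps) :
    TPow (freeModPair X Y) (Cosets V.1) :=
  traceSection X Y H V.1 (x (c.toS V) - c.ghost (fun W : c.reps =>
    if W.1.toSubgroup.index < V.1.toSubgroup.index then Choices.ghostSection x W else 0) (c.toS V))
termination_by V.1.toSubgroup.index

theorem Choices.ghostSection_eq (x : ∀ U : S.carrier, TPow (freeModPair X Y) (Cosets U.1))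
    (V : c.reps) : c.ghostSection x V = traceSection X Y H V.1 (x (c.toS V) -
      c.ghost (c.truncate V.1.toSubgroup.index (c.ghostSection x)) (c.toS V)) := by
  rw [Choices.ghostSection]
  rfl

theorem Choices.continuous_ghostSection : Continuous (c.ghostSection (X := X) (Y := Y)) := by
  have key : ∀ (N : ℕ) (V : c.reps), V.1.toSubgroup.index = N →
      Continuous fun x => c.ghostSection (X := X) (Y := Y) x V := by
    intro N
    induction N using Nat.strong_induction_on with
    | _ N ih =>
      rintro V rfl
      simp only [c.ghostSection_eq _ V]
      have h1 : Continuous fun x : ∀ U : S.carrier, TPow (freeModPair X Y) (Cosets U.1) =>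
          c.truncate V.1.toSubgroup.index (c.ghostSection x) := by
        refine continuous_pi fun W => ?_
        unfold Choices.truncate
        by_cases hW : W.1.toSubgroup.index < V.1.toSubgroup.index
        · simp only [if_pos hW]
          exact ih _ hW W rfl
        · simp only [if_neg hW]
          exact continuous_const
      have h2 := (continuous_apply (c.toS V)).comp (c.continuous_ghost.comp h1)
      exact (continuous_of_discreteTopology (f := traceSection X Y H V.1)).comp
        ((continuous_apply (c.toS V)).sub h2)
  exact continuous_pi fun V => key _ V rfl

/-- For free coefficients, every family in the closure of the span of the additive ghost components
is a value of the ghost map. -/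
theorem Choices.ghost_ghostSection {x : ∀ U : S.carrier, TPow (freeModPair X Y) (Cosets U.1)}
    (hx : x ∈ ghostSpan S X Y) : c.ghost (c.ghostSection x) = x := by
  have hxg := ghostSpan_le_ghostSubgroup hx
  have hng := ghostSpan_le_ghostSubgroup (c.ghost_mem_ghostSpan (c.ghostSection x))
  have key : ∀ (N : ℕ) (V : c.reps), V.1.toSubgroup.index = N →
      c.ghost (c.ghostSection x) (c.toS V) = x (c.toS V) := by
    intro N
    induction N using Nat.strong_induction_on with
    | _ N ih =>
      rintro V rfl
      -- subtracting the contributions of smaller index leaves a family vanishing above `V`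
      have hex := c.exists_theta_eq V
        (y := x - c.ghost (c.truncate V.1.toSubgroup.index (c.ghostSection x)))
        (sub_mem hx (c.ghost_mem_ghostSpan _)) fun U hU => ?_
      · rw [c.ghost_self, c.ghostSection_eq x V]
        exact (congrArg _ (theta_traceSection hex)).trans (add_sub_cancel _ _)
      · have hidx := index_lt_of_lt hU
        rw [Pi.sub_apply, c.ghost_truncate _ hidx, sub_eq_zero, eq_comm]
        obtain ⟨V', h, hh, e⟩ := c.exists_conj_mem_reps U
        refine (act_injective_ghost hng hxg hh (V := c.toS V') e).mpr (ih _ ?_ V' rfl)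
        rwa [← e, index_conj]
  funext U
  obtain ⟨V', h, hh, e⟩ := c.exists_conj_mem_reps U
  exact (act_injective_ghost hng hxg hh (V := c.toS V') e).mpr (key _ V' rfl)

theorem Choices.range_ghost : Set.range (c.ghost (P := freeModPair X Y)) = ghostSpan S X Y := by
  refine Set.Subset.antisymm ?_ fun x hx => ⟨_, c.ghost_ghostSection hx⟩
  rintro _ ⟨n, rfl⟩
  exact c.ghost_mem_ghostSpan n

end Ghost

/-! ### Existence of the Witt vector functor -/

section HausAb

variable {A B C : HausAb.{u}}

theorem HausAb.hom_ext {f g : A ⟶ B} (h : ∀ x, f.hom x = g.hom x) : f = g :=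
  HausAb.Hom.ext (ContinuousAddMonoidHom.ext h)

theorem HausAb.cancel_surjective {f : A ⟶ B} (hf : Function.Surjective f.hom) {g h : B ⟶ C}
    (e : f ≫ g = f ≫ h) : g = h := by
  refine HausAb.hom_ext fun x => ?_
  obtain ⟨x, rfl⟩ := hf x
  exact congrArg (fun k : A ⟶ C => k.hom x) e

theorem HausAb.cancel_injective {f : B ⟶ C} (hf : Function.Injective f.hom) {g h : A ⟶ B}
    (e : g ≫ f = h ≫ f) : g = h :=
  HausAb.hom_ext fun x => hf (congrArg (fun k : A ⟶ C => k.hom x) e)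

end HausAb

section Witt

variable {G : Type u} [Group G] [TopologicalSpace G] [IsTopologicalGroup G] [CompactSpace G]
  {H : OpenSubgroup G} {S : TruncationSet H} (c : Choices S)

/-- The ghost map on coordinates of a free object, with values in its image. -/
def Choices.ghostTo (X Y : Type u) (n : ∀ V : c.reps, TPow (freeModPair X Y) (Cosets V.1)) :
    ghostSpan S X Y :=
  ⟨c.ghost n, c.ghost_mem_ghostSpan n⟩

variable {X Y X' Y' : Type u}

theorem Choices.ghostTo_surjective : Function.Surjective (c.ghostTo X Y) :=
  fun x => ⟨_, Subtype.ext (c.ghost_ghostSection x.2)⟩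

theorem Choices.isQuotientMap_ghostTo : IsQuotientMap (c.ghostTo X Y) :=
  IsQuotientMap.of_inverse (f := fun x : ghostSpan S X Y => c.ghostSection x.1)
    (c.continuous_ghostSection.comp continuous_subtype_val)
    (c.continuous_ghost.subtype_mk _) fun x => Subtype.ext (c.ghost_ghostSection x.2)

theorem Choices.coordMap_comp {P Q R : ModPair.{u}} (f : P ⟶ Q) (g : Q ⟶ R)
    (n : ∀ V : c.reps, TPow P (Cosets V.1)) :
    c.coordMap (f ≫ g) n = c.coordMap g (c.coordMap f n) :=
  funext fun V => TPow.map_comp f g (n V)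

/-- The image of the ghost map is functorial on free objects. -/
def Choices.spanMap (f : freeModPair X Y ⟶ freeModPair X' Y') :
    ghostSpan S X Y →ₜ+ ghostSpan S X' Y' where
  toFun x := ⟨fun U => TPow.map _ f (x.1 U), by
    obtain ⟨n, rfl⟩ := c.ghostTo_surjective x
    have : (fun U => TPow.map _ f ((c.ghostTo X Y n).1 U)) = c.ghost (c.coordMap f n) :=
      funext fun U => c.map_ghost f n U
    rw [this]
    exact c.ghost_mem_ghostSpan _⟩
  map_zero' := Subtype.ext (funext fun U => map_zero (TPow.map _ f))
  map_add' x y := Subtype.ext (funext fun U => map_add (TPow.map _ f) (x.1 U) (y.1 U))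
  continuous_toFun := by
    refine Continuous.subtype_mk (continuous_pi fun U => ?_) _
    exact continuous_of_discreteTopology.comp ((continuous_apply U).comp continuous_subtype_val)

theorem Choices.spanMap_ghostTo (f : freeModPair X Y ⟶ freeModPair X' Y')
    (n : ∀ V : c.reps, TPow (freeModPair X Y) (Cosets V.1)) :
    c.spanMap f (c.ghostTo X Y n) = c.ghostTo X' Y' (c.coordMap f n) :=
  Subtype.ext (funext fun U => c.map_ghost f n U)

/-- The inclusion of the image of the ghost map into the ghost group. -/
def spanIncl (S : TruncationSet H) (X Y : Type u) :
    ghostSpan S X Y →ₜ+ ghostSubgroup S (freeModPair X Y) where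
  toFun x := ⟨x.1, ghostSpan_le_ghostSubgroup x.2⟩
  map_zero' := rfl
  map_add' _ _ := rfl
  continuous_toFun := continuous_subtype_val.subtype_mk _

theorem isEmbedding_spanIncl : IsEmbedding (spanIncl S X Y) :=
  IsEmbedding.of_comp (spanIncl S X Y).continuous_toFun continuous_subtype_val
    IsEmbedding.subtypeVal

/-- The closed subgroup of relations that the presentation `cover P ⟶ P` imposes. -/
def Choices.relations (P : ModPair.{u}) : AddSubgroup (ghostSpan S P.ring P.mod) :=
  (AddSubgroup.closure {z | ∃ a b : ∀ V : c.reps, TPow (cover P) (Cosets V.1),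
    c.coordMap (cover.ε P) a = c.coordMap (cover.ε P) b ∧
      c.ghostTo _ _ a - c.ghostTo _ _ b = z}).topologicalClosure

instance (P : ModPair.{u}) : IsClosed (c.relations P : Set (ghostSpan S P.ring P.mod)) :=
  AddSubgroup.isClosed_topologicalClosure _

/-- The group of Witt vectors of `P`: the image of the ghost map of the free cover of `P`, modulo
the relations of the presentation. -/
def Choices.wittObj (P : ModPair.{u}) : HausAb.{u} where
  carrier := ghostSpan S P.ring P.mod ⧸ c.relations P

/-- The projection from the image of the ghost map of `cover P` to the Witt vectors of `P`. -/
def Choices.wittMk (P : ModPair.{u}) : ghostSpan S P.ring P.mod →ₜ+ c.wittObj P where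
  toAddMonoidHom := QuotientAddGroup.mk' (c.relations P)
  continuous_toFun := QuotientAddGroup.continuous_mk

theorem Choices.isQuotientMap_wittMk (P : ModPair.{u}) : IsQuotientMap (c.wittMk P) :=
  QuotientAddGroup.isQuotientMap_mk (c.relations P)

theorem Choices.wittMk_ghostTo_surjective {P : ModPair.{u}} (x : c.wittObj P) :
    ∃ a, c.wittMk P (c.ghostTo _ _ a) = x := by
  obtain ⟨y, rfl⟩ := (c.isQuotientMap_wittMk P).surjective x
  obtain ⟨a, rfl⟩ := c.ghostTo_surjective y
  exact ⟨a, rfl⟩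

theorem Choices.wittMk_eq {P : ModPair.{u}} {a b : ∀ V : c.reps, TPow (cover P) (Cosets V.1)}
    (h : c.coordMap (cover.ε P) a = c.coordMap (cover.ε P) b) :
    c.wittMk P (c.ghostTo _ _ a) = c.wittMk P (c.ghostTo _ _ b) := by
  rw [← sub_eq_zero, ← map_sub]
  exact (QuotientAddGroup.eq_zero_iff _).mpr
    (AddSubgroup.le_topologicalClosure _ (AddSubgroup.subset_closure ⟨a, b, h, rfl⟩))

theorem Choices.exists_wittLift {P : ModPair.{u}} {A : Type*} [AddCommGroup A]
    [TopologicalSpace A] [T1Space A] (φ : ghostSpan S P.ring P.mod →ₜ+ A)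
    (hφ : ∀ a b : ∀ V : c.reps, TPow (cover P) (Cosets V.1),
      c.coordMap (cover.ε P) a = c.coordMap (cover.ε P) b →
        φ (c.ghostTo _ _ a) = φ (c.ghostTo _ _ b)) :
    ∃ ψ : c.wittObj P →ₜ+ A, ∀ x, ψ (c.wittMk P x) = φ x := by
  have hker : c.relations P ≤ φ.toAddMonoidHom.ker := by
    refine AddSubgroup.topologicalClosure_minimal _ ((AddSubgroup.closure_le _).mpr ?_)
      (isClosed_singleton.preimage φ.continuous_toFun)
    rintro _ ⟨a, b, h, rfl⟩
    change φ _ = 0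
    rw [map_sub, hφ a b h, sub_self]
  exact ⟨{ toAddMonoidHom := QuotientAddGroup.lift (c.relations P) φ.toAddMonoidHom hker
           continuous_toFun :=
            (c.isQuotientMap_wittMk P).continuous_iff.mpr φ.continuous_toFun }, fun x => rfl⟩

/-- A continuous homomorphism out of the Witt vectors of `P`, from one that is defined on the
presentation and respects the relations. -/
def Choices.wittLift {P : ModPair.{u}} {A : Type*} [AddCommGroup A]
    [TopologicalSpace A] [T1Space A] (φ : ghostSpan S P.ring P.mod →ₜ+ A)
    (hφ : ∀ a b : ∀ V : c.reps, TPow (cover P) (Cosets V.1),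
      c.coordMap (cover.ε P) a = c.coordMap (cover.ε P) b →
        φ (c.ghostTo _ _ a) = φ (c.ghostTo _ _ b)) : c.wittObj P →ₜ+ A :=
  (c.exists_wittLift φ hφ).choose

theorem Choices.wittLift_mk {P : ModPair.{u}} {A : Type*} [AddCommGroup A]
    [TopologicalSpace A] [T1Space A] (φ : ghostSpan S P.ring P.mod →ₜ+ A) (hφ)
    (x : ghostSpan S P.ring P.mod) : c.wittLift φ hφ (c.wittMk P x) = φ x :=
  (c.exists_wittLift φ hφ).choose_spec x

/-- The map induced on Witt vectors by a morphism of `Mod`. -/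
def Choices.wittMap {P Q : ModPair.{u}} (f : P ⟶ Q) : c.wittObj P →ₜ+ c.wittObj Q :=
  c.wittLift ((c.wittMk Q).comp (c.spanMap (cover.map f))) fun a b h => by
    change c.wittMk Q (c.spanMap _ _) = c.wittMk Q (c.spanMap _ _)
    rw [c.spanMap_ghostTo, c.spanMap_ghostTo]
    refine c.wittMk_eq ?_
    rw [← c.coordMap_comp, ← c.coordMap_comp, cover.map_ε, c.coordMap_comp, c.coordMap_comp, h]

theorem Choices.wittMap_mk {P Q : ModPair.{u}} (f : P ⟶ Q)
    (a : ∀ V : c.reps, TPow (cover P) (Cosets V.1)) :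
    c.wittMap f (c.wittMk P (c.ghostTo _ _ a))
      = c.wittMk Q (c.ghostTo _ _ (c.coordMap (cover.map f) a)) :=
  (c.wittLift_mk _ _ _).trans (congrArg _ (c.spanMap_ghostTo _ _))

/-- The functor of Witt vectors. -/
def Choices.witt : ModPair.{u} ⥤ HausAb.{u} where
  obj := c.wittObj
  map f := ⟨c.wittMap f⟩
  map_id P := by
    refine HausAb.hom_ext fun x => ?_
    obtain ⟨a, rfl⟩ := c.wittMk_ghostTo_surjective x
    change c.wittMap _ _ = c.wittMk P _
    rw [c.wittMap_mk, cover.map_id]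
    congr 2
    exact funext fun V => TPow.map_id (a V)
  map_comp f g := by
    refine HausAb.hom_ext fun x => ?_
    obtain ⟨a, rfl⟩ := c.wittMk_ghostTo_surjective x
    change c.wittMap _ _ = c.wittMap _ (c.wittMap _ _)
    rw [c.wittMap_mk, c.wittMap_mk, c.wittMap_mk, cover.map_comp, c.coordMap_comp]

theorem ghostMap_spanIncl_ghostTo {P : ModPair.{u}} (f : freeModPair X Y ⟶ P)
    (n : ∀ V : c.reps, TPow (freeModPair X Y) (Cosets V.1)) :
    (ghostMap S f (spanIncl S X Y (c.ghostTo X Y n))).1 = c.ghost (c.coordMap f n) :=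
  funext fun U => c.map_ghost f n U

/-- The ghost map on the Witt vectors of `P`. -/
def Choices.wittGhost (P : ModPair.{u}) : c.wittObj P →ₜ+ ghostSubgroup S P :=
  c.wittLift ((ghostMap S (cover.ε P)).comp (spanIncl S P.ring P.mod)) fun a b h => by
    refine Subtype.ext ?_
    change (ghostMap S _ (spanIncl S _ _ _)).1 = (ghostMap S _ (spanIncl S _ _ _)).1
    rw [ghostMap_spanIncl_ghostTo, ghostMap_spanIncl_ghostTo, h]

theorem Choices.wittGhost_mk {P : ModPair.{u}} (x : ghostSpan S P.ring P.mod) :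
    c.wittGhost P (c.wittMk P x) = ghostMap S (cover.ε P) (spanIncl S P.ring P.mod x) :=
  c.wittLift_mk _ _ x

theorem Choices.wittGhost_mk_ghostTo {P : ModPair.{u}}
    (a : ∀ V : c.reps, TPow (cover P) (Cosets V.1)) :
    (c.wittGhost P (c.wittMk P (c.ghostTo _ _ a))).1 = c.ghost (c.coordMap (cover.ε P) a) := by
  rw [c.wittGhost_mk, ghostMap_spanIncl_ghostTo]

/-- The ghost map as a natural transformation. -/
def Choices.wittTrans : c.witt ⟶ gh S where
  app P := ⟨c.wittGhost P⟩
  naturality P Q f := by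
    refine HausAb.hom_ext fun x => ?_
    obtain ⟨a, rfl⟩ := c.wittMk_ghostTo_surjective x
    refine Subtype.ext ?_
    change (c.wittGhost Q (c.wittMap f _)).1 = (ghostMap S f (c.wittGhost P _)).1
    rw [c.wittMap_mk, c.wittGhost_mk_ghostTo, ← c.coordMap_comp, cover.map_ε, c.coordMap_comp]
    funext U
    rw [← c.map_ghost f, ← c.wittGhost_mk_ghostTo]
    rfl

theorem Choices.coordMap_surjective {P Q : ModPair.{u}} {f : P ⟶ Q}
    (hr : Function.Surjective f.ringHom) (hm : Function.Surjective f.modHom) :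
    Function.Surjective (c.coordMap f) := fun n =>
  ⟨fun V => (TPow.map_surjective hr hm (n V)).choose,
    funext fun V => (TPow.map_surjective hr hm (n V)).choose_spec⟩

/-- A lift of the coordinates of `P` to its free cover. -/
def Choices.coordLift (P : ModPair.{u}) (n : ∀ V : c.reps, TPow P (Cosets V.1)) (V : c.reps) :
    TPow (cover P) (Cosets V.1) :=
  (TPow.map_surjective (cover.ε_ring_surjective P) (cover.ε_mod_surjective P) (n V)).choose

theorem Choices.coordMap_coordLift (P : ModPair.{u}) (n : ∀ V : c.reps, TPow P (Cosets V.1)) :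
    c.coordMap (cover.ε P) (c.coordLift P n) = n := funext fun V =>
  (TPow.map_surjective (cover.ε_ring_surjective P) (cover.ε_mod_surjective P) (n V)).choose_spec

theorem continuous_piMap_discrete {ι : Type*} {A B : ι → Type*} [∀ i, TopologicalSpace (A i)]
    [∀ i, DiscreteTopology (A i)] [∀ i, TopologicalSpace (B i)] (f : ∀ i, A i → B i) :
    Continuous fun (a : ∀ i, A i) i => f i (a i) :=
  continuous_pi fun i => (continuous_of_discreteTopology (f := f i)).comp (continuous_apply i)

/-- The coordinates of Witt vectors. -/
def Choices.wittCoord (P : ModPair.{u}) (n : ∀ V : c.reps, TPow P (Cosets V.1)) : c.wittObj P :=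
  c.wittMk P (c.ghostTo _ _ (c.coordLift P n))

theorem Choices.wittCoord_coordMap {P : ModPair.{u}}
    (a : ∀ V : c.reps, TPow (cover P) (Cosets V.1)) :
    c.wittCoord P (c.coordMap (cover.ε P) a) = c.wittMk P (c.ghostTo _ _ a) :=
  c.wittMk_eq (c.coordMap_coordLift P _)

theorem Choices.isQuotientMap_wittCoord (P : ModPair.{u}) : IsQuotientMap (c.wittCoord P) := by
  have h1 : Continuous (c.coordLift P) := continuous_piMap_discrete fun (V : c.reps) n =>
    (TPow.map_surjective (cover.ε_ring_surjective P) (cover.ε_mod_surjective P) n).choose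
  have h2 : Continuous (c.coordMap (cover.ε P)) := continuous_piMap_discrete fun (V : c.reps) n =>
    TPow.map _ (cover.ε P) n
  have h3 := (c.isQuotientMap_wittMk P).comp c.isQuotientMap_ghostTo
  refine IsQuotientMap.of_comp h2 (h3.continuous.comp h1) ?_
  convert! h3 using 1
  exact funext fun a => c.wittCoord_coordMap a

theorem Choices.wittCoord_natural {P Q : ModPair.{u}} (f : P ⟶ Q)
    (n : ∀ V : c.reps, TPow P (Cosets V.1)) :
    c.wittCoord Q (c.coordMap f n) = c.wittMap f (c.wittCoord P n) := by
  obtain ⟨a, rfl⟩ := c.coordMap_surjective (cover.ε_ring_surjective P) (cover.ε_mod_surjective P) n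
  rw [← c.coordMap_comp, ← cover.map_ε, c.coordMap_comp, c.wittCoord_coordMap,
    c.wittCoord_coordMap, c.wittMap_mk]

/-- If the cover of `P` splits then the ghost map of `P` is an embedding: the splitting embeds the
Witt vectors of `P` into the image of the ghost map of the cover. -/
theorem Choices.isEmbedding_wittGhost {P : ModPair.{u}} (s : P ⟶ cover P)
    (hs : s ≫ cover.ε P = 𝟙 P) : IsEmbedding (c.wittGhost P) := by
  have hε : (cover.ε P ≫ s) ≫ cover.ε P = cover.ε P := by
    rw [Category.assoc, hs, Category.comp_id]
  let v : c.wittObj P →ₜ+ ghostSpan S P.ring P.mod :=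
    c.wittLift (c.spanMap (cover.ε P ≫ s)) fun a b h => by
      rw [c.spanMap_ghostTo, c.spanMap_ghostTo, c.coordMap_comp, c.coordMap_comp, h]
  have hv : ∀ a, v (c.wittMk P (c.ghostTo _ _ a))
      = c.ghostTo _ _ (c.coordMap (cover.ε P ≫ s) a) := fun a =>
    (c.wittLift_mk _ _ _).trans (c.spanMap_ghostTo _ _)
  have hinv : Function.LeftInverse (c.wittMk P) v := by
    intro x
    obtain ⟨a, rfl⟩ := c.wittMk_ghostTo_surjective x
    rw [hv]
    refine c.wittMk_eq ?_
    rw [← c.coordMap_comp, hε]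
  have hvemb : IsEmbedding v :=
    hinv.isEmbedding (c.wittMk P).continuous_toFun v.continuous_toFun
  refine IsEmbedding.of_comp (c.wittGhost P).continuous_toFun (ghostMap S s).continuous_toFun ?_
  convert! isEmbedding_spanIncl.comp hvemb using 1
  funext x
  obtain ⟨a, rfl⟩ := c.wittMk_ghostTo_surjective x
  refine Subtype.ext ?_
  change (ghostMap S s (c.wittGhost P _)).1 = (spanIncl S _ _ (v _)).1
  rw [hv]
  change _ = c.ghost _
  rw [c.coordMap_comp]
  funext U
  rw [← c.map_ghost s, ← c.wittGhost_mk_ghostTo]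
  rfl

theorem ModPair.IsFree.exists_section {P : ModPair.{u}} (hP : P.IsFree) :
    ∃ s : P ⟶ cover P, s ≫ cover.ε P = 𝟙 P := by
  obtain ⟨X, Y, ⟨e⟩⟩ := hP
  obtain ⟨l, hl⟩ := exists_free_lift (cover.ε_ring_surjective P) (cover.ε_mod_surjective P) e.inv
  exact ⟨e.hom ≫ l, by rw [Category.assoc, hl, e.hom_inv_id]⟩

/-- The Witt vector functor turns exact forks into coequalisers. -/
theorem Choices.witt_isColimit {A B C : ModPair.{u}} {f g : A ⟶ B} {p : B ⟶ C}
    (h : ExactFork f g p) :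
    Nonempty (IsColimit (c.witt.mapCocone (Cofork.ofπ p h.w))) := by
  -- a map that coequalises the pair depends only on the image in `C` of the coordinates
  have hcoord : ∀ {Z : HausAb.{u}} (φ : c.witt.obj B ⟶ Z),
      c.witt.map f ≫ φ = c.witt.map g ≫ φ → ∀ a b : ∀ V : c.reps, TPow (cover B) (Cosets V.1),
      c.coordMap (cover.ε B ≫ p) a = c.coordMap (cover.ε B ≫ p) b →
      φ.hom (c.wittMk B (c.ghostTo _ _ a)) = φ.hom (c.wittMk B (c.ghostTo _ _ b)) := by
    intro Z φ hφ a b hab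
    rw [c.coordMap_comp, c.coordMap_comp] at hab
    choose d hd hd' using fun V => h.tpow_exact _ _ (congrFun hab V)
    rw [← c.wittCoord_coordMap, ← c.wittCoord_coordMap, ← funext hd, ← funext hd']
    change φ.hom (c.wittCoord B (c.coordMap f d)) = φ.hom (c.wittCoord B (c.coordMap g d))
    rw [c.wittCoord_natural, c.wittCoord_natural]
    exact congrArg (fun k : c.witt.obj A ⟶ Z => k.hom (c.wittCoord A d)) hφ
  obtain ⟨l, hl⟩ := exists_free_lift (p := cover.ε B ≫ p)
    (h.ring_surj.comp (cover.ε_ring_surjective B)) (h.mod_surj.comp (cover.ε_mod_surjective B))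
    (cover.ε C)
  have hex : ∀ (Z : HausAb.{u}) (φ : c.witt.obj B ⟶ Z), c.witt.map f ≫ φ = c.witt.map g ≫ φ →
      ∃ d : c.witt.obj C ⟶ Z, ∀ x, d.hom (c.wittMk C x) = φ.hom (c.wittMk B (c.spanMap l x)) := by
    intro Z φ hφ
    obtain ⟨d, hd⟩ := c.exists_wittLift (φ.hom.comp ((c.wittMk B).comp (c.spanMap l)))
      fun a b hab => by
        change φ.hom (c.wittMk B (c.spanMap l _)) = φ.hom (c.wittMk B (c.spanMap l _))
        rw [c.spanMap_ghostTo, c.spanMap_ghostTo]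
        refine hcoord φ hφ _ _ ?_
        rw [← c.coordMap_comp, ← c.coordMap_comp, hl, hab]
    exact ⟨⟨d⟩, hd⟩
  choose desc hdesc using hex
  have hsurj : Function.Surjective (c.witt.map p).hom := by
    intro x
    obtain ⟨n, rfl⟩ := (c.isQuotientMap_wittCoord C).surjective x
    obtain ⟨n, rfl⟩ := c.coordMap_surjective h.ring_surj h.mod_surj n
    exact ⟨c.wittCoord B n, (c.wittCoord_natural p n).symm⟩
  have hfac : ∀ (Z : HausAb.{u}) (φ : c.witt.obj B ⟶ Z)
      (hφ : c.witt.map f ≫ φ = c.witt.map g ≫ φ), c.witt.map p ≫ desc Z φ hφ = φ := by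
    intro Z φ hφ
    refine HausAb.hom_ext fun x => ?_
    obtain ⟨a, rfl⟩ := c.wittMk_ghostTo_surjective x
    change (desc Z φ hφ).hom (c.wittMap p _) = _
    rw [c.wittMap_mk, hdesc, c.spanMap_ghostTo]
    refine hcoord φ hφ _ _ ?_
    rw [← c.coordMap_comp, ← c.coordMap_comp, hl, cover.map_ε]
  exact ⟨(isColimitMapCoconeCoforkEquiv c.witt h.w).symm
    (Cofork.IsColimit.mk _ (fun s => desc s.pt s.π s.condition)
      (fun s => hfac s.pt s.π s.condition)
      fun s m hm => HausAb.cancel_surjective hsurj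
        (hm.trans (hfac s.pt s.π s.condition).symm))⟩

theorem Choices.isWitt : IsWitt c c.witt c.wittTrans where
  exists_quotient := ⟨c.wittCoord, c.isQuotientMap_wittCoord,
    fun _ _ f n => c.wittCoord_natural f n, fun P n => by
      change (c.wittGhost P (c.wittMk P (c.ghostTo _ _ _))).1 = _
      rw [c.wittGhost_mk_ghostTo, c.coordMap_coordLift]⟩
  isEmbedding P hP := by
    obtain ⟨s, hs⟩ := hP.exists_section
    exact c.isEmbedding_wittGhost s hs
  preservesReflexive f g hfg := by
    obtain ⟨C, p, h⟩ := exists_exactFork f g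
    exact preservesColimit_of_preserves_colimit_cocone h.isColimit (c.witt_isColimit h).some

end Witt

/-! ### Uniqueness of the Witt vector functor -/

section Unique

variable {G : Type u} [Group G] [TopologicalSpace G] [IsTopologicalGroup G] [CompactSpace G]
  {H : OpenSubgroup G} {S : TruncationSet H} {c c' : Choices S}
  {W W' : ModPair.{u} ⥤ HausAb.{u}} {w : W ⟶ gh S} {w' : W' ⟶ gh S}

theorem freeModPair_isFree (X Y : Type u) : (freeModPair X Y).IsFree :=
  ⟨X, Y, ⟨Iso.refl _⟩⟩

theorem IsWitt.map_surjective (hW : IsWitt c W w) {P Q : ModPair.{u}} {f : P ⟶ Q}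
    (hr : Function.Surjective f.ringHom) (hm : Function.Surjective f.modHom) :
    Function.Surjective (W.map f).hom := by
  obtain ⟨q, hq, hnat, -⟩ := hW.exists_quotient
  intro x
  obtain ⟨n, rfl⟩ := (hq Q).surjective x
  obtain ⟨n, rfl⟩ := c.coordMap_surjective hr hm n
  exact ⟨q P n, (hnat P Q f n).symm⟩

theorem IsWitt.injective (hW : IsWitt c W w) (X Y : Type u) :
    Function.Injective (w.app (freeModPair X Y)).hom :=
  (hW.isEmbedding _ (freeModPair_isFree X Y)).injective

/-- On free objects the image of the ghost map of a Witt vector functor does not depend on the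
functor, nor on the choices of representatives. -/
theorem IsWitt.exists_eq_iff (hW : IsWitt c W w) {X Y : Type u}
    (x : (gh S).obj (freeModPair X Y)) :
    (∃ y, (w.app (freeModPair X Y)).hom y = x) ↔ x.1 ∈ ghostSpan S X Y := by
  obtain ⟨q, hq, -, hw⟩ := hW.exists_quotient
  rw [← SetLike.mem_coe, ← c.range_ghost]
  constructor
  · rintro ⟨y, rfl⟩
    obtain ⟨n, rfl⟩ := (hq _).surjective y
    exact ⟨n, (hw _ n).symm⟩
  · rintro ⟨n, hn⟩
    exact ⟨q _ n, Subtype.ext ((hw _ n).trans hn)⟩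

theorem IsWitt.exists_freeHom (hW : IsWitt c W w) (hW' : IsWitt c' W' w') (X Y : Type u) :
    ∃ v : W.obj (freeModPair X Y) ⟶ W'.obj (freeModPair X Y),
      v ≫ w'.app (freeModPair X Y) = w.app (freeModPair X Y) := by
  have h : ∀ x, ∃ y, (w'.app (freeModPair X Y)).hom y = (w.app (freeModPair X Y)).hom x :=
    fun x => (hW'.exists_eq_iff _).mpr ((hW.exists_eq_iff _).mp ⟨x, rfl⟩)
  choose v hv using h
  have hinj := hW'.injective X Y
  refine ⟨⟨⟨AddMonoidHom.mk' v fun x y => hinj ?_, ?_⟩⟩, HausAb.hom_ext hv⟩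
  · rw [map_add, hv, hv, hv, map_add]
  · refine (hW'.isEmbedding _ (freeModPair_isFree X Y)).continuous_iff.mpr ?_
    convert! (w.app (freeModPair X Y)).hom.continuous_toFun using 1
    exact funext hv

/-- Two Witt vector functors, possibly for different choices, admit a unique natural
transformation over the ghost group: it is forced on free objects, and every object is a reflexive
coequaliser of free objects up to surjections. -/
theorem IsWitt.existsUnique_hom (hW : IsWitt c W w) (hW' : IsWitt c' W' w') :
    ∃! u : W ⟶ W', u ≫ w' = w := by
  choose v hv using fun X Y => hW.exists_freeHom hW' X Y
  have hvnat : ∀ {X Y X' Y' : Type u} (k : freeModPair X Y ⟶ freeModPair X' Y'),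
      W.map k ≫ v X' Y' = v X Y ≫ W'.map k := by
    intro X Y X' Y' k
    refine HausAb.cancel_injective (hW'.injective X' Y') ?_
    rw [Category.assoc, hv, Category.assoc, w'.naturality, ← Category.assoc, hv, w.naturality]
  have hex : ∀ P : ModPair.{u}, ∃ u : W.obj P ⟶ W'.obj P,
      W.map (cover.ε P) ≫ u = v _ _ ≫ W'.map (cover.ε P) := by
    intro P
    let fork := kernelPair.exactFork (cover.ε P) (cover.ε_ring_surjective P)
      (cover.ε_mod_surjective P)
    have := hW.preservesReflexive _ _ (kernelPair.isReflexivePair (cover.ε P))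
    let hcol := isColimitMapCoconeCoforkEquiv W fork.w (isColimitOfPreserves W fork.isColimit)
    refine ⟨Cofork.IsColimit.desc hcol (v _ _ ≫ W'.map (cover.ε P)) ?_,
      Cofork.IsColimit.π_desc' hcol _ _⟩
    -- test on the free cover of the kernel pair
    refine HausAb.cancel_surjective (hW.map_surjective (cover.ε_ring_surjective _)
      (cover.ε_mod_surjective (kernelPair (cover.ε P)))) ?_
    have key : ∀ k : kernelPair (cover.ε P) ⟶ cover P,
        W.map (cover.ε _) ≫ W.map k ≫ v _ _ ≫ W'.map (cover.ε P)
          = v _ _ ≫ W'.map (cover.ε _ ≫ k ≫ cover.ε P) := by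
      intro k
      rw [← W.map_comp_assoc, ← Category.assoc, hvnat, Category.assoc, ← W'.map_comp,
        Category.assoc]
    rw [key, key, fork.w]
  choose u hu using hex
  have hsurj : ∀ P, Function.Surjective (W.map (cover.ε P)).hom := fun P =>
    hW.map_surjective (cover.ε_ring_surjective P) (cover.ε_mod_surjective P)
  refine ⟨⟨u, fun P Q f => ?_⟩, ?_, fun t ht => ?_⟩
  · refine HausAb.cancel_surjective (hsurj P) ?_
    rw [← W.map_comp_assoc, ← cover.map_ε, W.map_comp, Category.assoc, hu, ← Category.assoc, hvnat,
      Category.assoc, ← W'.map_comp, cover.map_ε, W'.map_comp, ← Category.assoc, ← hu,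
      Category.assoc]
  · ext P : 2
    refine HausAb.cancel_surjective (hsurj P) ?_
    rw [NatTrans.comp_app, ← Category.assoc, hu, Category.assoc, w'.naturality, ← Category.assoc,
      hv, w.naturality]
  · have hfree : ∀ X Y : Type u, t.app (freeModPair X Y) = v X Y := fun X Y =>
      HausAb.cancel_injective (hW'.injective X Y) (by rw [← NatTrans.comp_app, ht, hv])
    ext P : 2
    refine HausAb.cancel_surjective (hsurj P) ?_
    rw [t.naturality, hfree, hu]

theorem IsWitt.existsUnique_iso (hW : IsWitt c W w) (hW' : IsWitt c' W' w') :
    ∃! u : W ≅ W', u.hom ≫ w' = w := by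
  obtain ⟨u, hu, huniq⟩ := hW.existsUnique_hom hW'
  obtain ⟨v, hv, -⟩ := hW'.existsUnique_hom hW
  refine ⟨⟨u, v, ?_, ?_⟩, hu, fun t ht => Iso.ext (huniq _ ht)⟩
  · exact (hW.existsUnique_hom hW).unique (by rw [Category.assoc, hv, hu]) (Category.id_comp w)
  · exact (hW'.existsUnique_hom hW').unique (by rw [Category.assoc, hu, hv]) (Category.id_comp w')

end Unique

end

end GWitt

theorem mainTheorem3 {G : Type u} [Group G] [TopologicalSpace G] [IsTopologicalGroup G]
    [CompactSpace G] [TotallyDisconnectedSpace G] (H : OpenSubgroup G)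
    (S : GWitt.TruncationSet H) :
    (∀ c : GWitt.Choices S,
      ∃ (W : GWitt.ModPair.{u} ⥤ GWitt.HausAb.{u}) (w : W ⟶ GWitt.gh S), GWitt.IsWitt c W w) ∧
    (∀ (c c' : GWitt.Choices S) (W W' : GWitt.ModPair.{u} ⥤ GWitt.HausAb.{u})
      (w : W ⟶ GWitt.gh S) (w' : W' ⟶ GWitt.gh S),
      GWitt.IsWitt c W w → GWitt.IsWitt c' W' w' → ∃! u : W ≅ W', u.hom ≫ w' = w) :=
  ⟨fun c => ⟨c.witt, c.wittTrans, c.isWitt⟩,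
    fun _ _ _ _ _ _ hW hW' => hW.existsUnique_iso hW'⟩
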